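/- An allowable sequence on $N$ points is a family $(\pi_i)_{i\in\mathbb Z}$ of permutations of $N$ points for which there is an $h\ge 1$ (the length of a halfperiod) such that: $\pi_{i+h}$ is the reversal of $\pi_i$ for all $i$; $\pi_i$ arises from $\pi_{i-1}$ by the reversal of one or more disjoint substrings of at least two consecutive elements (the switches of the $i$-th move); and any two points take part in a common switch exactly once in the moves $1,\dots,h$. A switch is crossing if it reverses a centered substring. For a sequence $d=(d_1,\dots,d_t)$ of positive integers with $t\ge 2$ and $n=d_1+\dots+d_t$, let $\mathrm{DC}^{cs}_{ncgen}(d)$ be the unique allowable sequence on $2n$ points $1,\dots,n,\overline n,\dots,\overline 1$ with $\pi_0=(1,2,\dots,n,\overline n,\dots,\overline 2,\overline 1)$ such that: $h=2n$ (it is even-near-critical); it is centrally symmetric, that is, each point has a conjugate whose position in every $\pi_i$ is the mirror image of its own; all switches other than the crossing ones reverse just two points; the crossing switches in the moves $1,\dots,h$ are, in order, $t$ switches reversing $2d_1,\dots,2d_t$ points; and the first move includes a crossing switch. A realization of an allowable sequence is a set $P$ of points in $\mathbb R^2$ whose circular sequence it is: after a suitable labelling of $P$ there are angles $\dots<c_{-1}<c_0<c_1<\dots$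 with $c_{i+h}=c_i+\pi$ such that $\pi_i$ is the order of the orthogonal projections of $P$ onto a line directed by $(\cos\varphi,\sin\varphi)$, for all $c_i<\varphi<c_{i+1}$. An allowable sequence is geometrically realizable if it has a realization. **Theorem.** Let $t\ge 3$ and let $d=(d_1,\dots,d_t)$ be a sequence of positive integers with $d_i=d_{i+1}=d_{i+2}=2$ for some $i$, the indices being taken modulo $t$. Then $\mathrm{DC}^{cs}_{ncgen}(d)$ is geometrically realizable if and only if $t=3$. Moreover, every realization of $\mathrm{DC}^{cs}_{ncgen}(2,2,2)$ is affinely equivalent (the image under a bijective affine map of the plane) to the set $(\mathrm Z5,12,6)$ of the twelve points $(\pm2,0)$, $(\pm2\tau,0)$, $(\pm1,\pm1)$, $(\pm\tau,\pm\tau)$ (all signs independent), where $\tau=(1+\sqrt5)/2$. -/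

import Mathlib

/-- `IsMove σ τ S`: the permutation with positions `τ` arises from the permutation with positions
`σ` by simultaneously reversing the substrings that occupy the positions `a, a+1, …, b`, where
`(a, b)` runs over `S`; there is at least one such substring, each has at least two elements, and
they are pairwise disjoint. Here `σ p` is the (zero-based) position of the point `p`. -/
structure IsMove {N : ℕ} (σ τ : Equiv.Perm (Fin N)) (S : Set (Fin N × Fin N)) : Prop where
  nonempty : S.Nonempty
  lt : ∀ s ∈ S, s.1 < s.2
  disjoint : S.PairwiseDisjoint (fun s => Set.Icc s.1 s.2)
  reverse : ∀ s ∈ S, ∀ p, σ p ∈ Set.Icc s.1 s.2 →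
    (τ p : ℕ) + (σ p : ℕ) = (s.1 : ℕ) + (s.2 : ℕ)
  fixed : ∀ p, (∀ s ∈ S, σ p ∉ Set.Icc s.1 s.2) → τ p = σ p

/-- An allowable sequence on the points `Fin N`, the points being labelled by their positions in
the permutation with index `0`. `pos i p` is the (zero-based) position of the point `p` in the
`i`-th permutation, `h` is the length of a halfperiod, and `switches i` is the set of switches of
the `i`-th move (from permutation `i - 1` to permutation `i`), a switch being given by the first and
last position of the reversed substring; this set is determined by the two permutations. -/
structure AllowableSequence (N : ℕ) where
  pos : ℤ → Equiv.Perm (Fin N)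
  switches : ℤ → Set (Fin N × Fin N)
  h : ℕ
  h_pos : 0 < h
  pos_zero : pos 0 = 1
  pos_add_h : ∀ i p, pos (i + h) p = (pos i p).rev
  isMove : ∀ i, IsMove (pos (i - 1)) (pos i) (switches i)
  existsUnique_switch : ∀ p q, p ≠ q → ∃! i : ℤ, (0 < i ∧ i ≤ h) ∧
    ∃ s ∈ switches i, pos (i - 1) p ∈ Set.Icc s.1 s.2 ∧ pos (i - 1) q ∈ Set.Icc s.1 s.2

/-- A switch is crossing if it reverses a centered substring. -/
def IsCrossing {N : ℕ} (s : Fin N × Fin N) : Prop := s.2 = s.1.rev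

namespace AllowableSequence

variable {N : ℕ}

/-- Every point has a conjugate, whose position is always the mirror image. -/
def IsCentrallySymmetric (A : AllowableSequence N) : Prop :=
  ∀ p, ∃ p', ∀ i, A.pos i p' = (A.pos i p).rev

/-- An even number of points and as many directions as points. -/
def IsEvenNearCritical (A : AllowableSequence N) : Prop :=
  Even N ∧ A.h = N

/-- All switches, except perhaps the crossing ones, are transpositions. -/
def IsNoncentralGeneral (A : AllowableSequence N) : Prop :=
  ∀ i, ∀ s ∈ A.switches i, IsCrossing s ∨ (s.2 : ℕ) = (s.1 : ℕ) + 1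

/-- The crossing switches of the moves `1, …, h` are, in order, `t` switches which reverse
`2 d₀, 2 d₁, …` points. -/
def HasCentralSignature (A : AllowableSequence N) {t : ℕ} (d : Fin t → ℕ) : Prop :=
  ∃ m : Fin t → ℤ, StrictMono m ∧
    (∀ i : ℤ, i ∈ Set.range m ↔ (0 < i ∧ i ≤ A.h) ∧ ∃ s ∈ A.switches i, IsCrossing s) ∧
    ∀ j, ∃ s ∈ A.switches (m j), IsCrossing s ∧ (s.2 : ℕ) + 1 = (s.1 : ℕ) + 2 * d j

/-- `A` is an even-near-critical centrally symmetric allowable sequence in noncentral general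
position with central signature `d` whose first move includes a crossing switch. -/
structure IsDC (A : AllowableSequence N) {t : ℕ} (d : Fin t → ℕ) : Prop where
  evenNearCritical : A.IsEvenNearCritical
  centrallySymmetric : A.IsCentrallySymmetric
  noncentralGeneral : A.IsNoncentralGeneral
  centralSignature : A.HasCentralSignature d
  first : ∃ s ∈ A.switches 1, IsCrossing s

/-- `A` is the circular sequence of the set `P` of points of the plane: `P` can be labelled by the
points of `A` and there is an increasing bi-infinite sequence of angles `c i` such that, for every
angle `φ` strictly between `c i` and `c (i + 1)`, the order of the orthogonal projections of `P`
onto a line directed by `(cos φ, sin φ)` is the `i`-th permutation of `A`; a halfperiod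
corresponds to a half turn of the line. -/
def IsRealization (A : AllowableSequence N) (P : Set (EuclideanSpace ℝ (Fin 2))) : Prop :=
  ∃ x : Fin N → EuclideanSpace ℝ (Fin 2), Set.range x = P ∧
    ∃ c : ℤ → ℝ, StrictMono c ∧ (∀ i, c (i + A.h) = c i + Real.pi) ∧
      ∀ i, ∀ φ ∈ Set.Ioo (c i) (c (i + 1)), ∀ p q, A.pos i p < A.pos i q ↔
        inner ℝ (x p) !₂[Real.cos φ, Real.sin φ] < inner ℝ (x q) !₂[Real.cos φ, Real.sin φ]

/-- Geometric realizability. -/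
def IsRealizable (A : AllowableSequence N) : Prop := ∃ P, A.IsRealization P

end AllowableSequence

/-- One set of points is the image of the other under a bijective affine map of the plane. -/
def AffinelyEquivalent (P Q : Set (EuclideanSpace ℝ (Fin 2))) : Prop :=
  ∃ e : EuclideanSpace ℝ (Fin 2) ≃ᵃ[ℝ] EuclideanSpace ℝ (Fin 2), e '' P = Q

/-- The twelve points `(±2, 0)`, `(±2τ, 0)`, `(±1, ±1)`, `(±τ, ±τ)`, where `τ` is the golden
ratio. -/
def Z5_12_6 : Set (EuclideanSpace ℝ (Fin 2)) :=
  let τ := Real.goldenRatio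
  {!₂[2, 0], !₂[-2, 0], !₂[2 * τ, 0], !₂[-(2 * τ), 0],
   !₂[1, 1], !₂[1, -1], !₂[-1, 1], !₂[-1, -1],
   !₂[τ, τ], !₂[τ, -τ], !₂[-τ, τ], !₂[-τ, -τ]}

/-! ### Existence of the sequences

For every `d` with at least two entries, all positive, there is a sequence with the properties
`IsDC d`. -/

/-- Two points take part in a common switch of a move iff the move changes their order. -/
theorem IsMove.flip_iff {N : ℕ} {σ τ : Equiv.Perm (Fin N)} {S : Set (Fin N × Fin N)}
    (H : IsMove σ τ S) {p q : Fin N} (hpq : p ≠ q) :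
    (∃ s ∈ S, σ p ∈ Set.Icc s.1 s.2 ∧ σ q ∈ Set.Icc s.1 s.2) ↔ (σ p < σ q ↔ ¬ τ p < τ q) := by
  have hσ : (σ p : ℕ) ≠ σ q := fun h => hpq (σ.injective (Fin.ext h))
  have hτ : (τ p : ℕ) ≠ τ q := fun h => hpq (τ.injective (Fin.ext h))
  have rv : ∀ s ∈ S, ∀ u, ((s.1 : ℕ) ≤ σ u ∧ (σ u : ℕ) ≤ s.2) →
      (τ u : ℕ) + (σ u : ℕ) = (s.1 : ℕ) + (s.2 : ℕ) := fun s hs u hu => H.reverse s hs u hu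
  have mem : ∀ u : Fin N, (∃ s ∈ S, (s.1 : ℕ) ≤ σ u ∧ (σ u : ℕ) ≤ s.2) ∨
      ((∀ s ∈ S, ¬ ((s.1 : ℕ) ≤ σ u ∧ (σ u : ℕ) ≤ s.2)) ∧ τ u = σ u) := by
    intro u
    by_cases h : ∃ s ∈ S, (s.1 : ℕ) ≤ σ u ∧ (σ u : ℕ) ≤ s.2
    · exact Or.inl h
    · push Not at h
      refine Or.inr ⟨fun s hs hh => absurd hh.2 (by have := h s hs hh.1; omega), H.fixed u ?_⟩
      intro s hs hm
      have := h s hs hm.1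
      have h2 : (σ u : ℕ) ≤ s.2 := hm.2
      omega
  have dj : ∀ s ∈ S, ∀ s' ∈ S, s ≠ s' → (s.2 : ℕ) < s'.1 ∨ (s'.2 : ℕ) < s.1 := by
    intro s hs s' hs' hne
    by_contra hc
    push Not at hc
    have h1 : (s.1 : ℕ) < s.2 := H.lt s hs
    have h2 : (s'.1 : ℕ) < s'.2 := H.lt s' hs'
    have := Set.disjoint_left.1 (H.disjoint hs hs' hne)
    rcases le_total (s.1 : ℕ) (s'.1 : ℕ) with h | h
    · exact this (a := s'.1) ⟨h, hc.1⟩ ⟨le_refl _, h2.le⟩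
    · exact this (a := s.1) ⟨le_refl _, h1.le⟩ ⟨h, hc.2⟩
  simp only [Fin.lt_def]
  constructor
  · rintro ⟨s, hs, hp, hq⟩
    have := H.reverse s hs p hp
    have := H.reverse s hs q hq
    omega
  · intro hf
    rcases mem p with ⟨s, hs, hsp⟩ | ⟨hnp, hp⟩
    · rcases mem q with ⟨s', hs', hsq⟩ | ⟨hnq, hq⟩
      · by_cases hss : s = s'
        · subst hss
          exact ⟨s, hs, ⟨hsp.1, hsp.2⟩, ⟨hsq.1, hsq.2⟩⟩
        · exfalso
          have := dj s hs s' hs' hss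
          have := rv s hs p hsp
          have := rv s' hs' q hsq
          omega
      · exfalso
        have := hnq s hs
        have := rv s hs p hsp
        rw [hq] at hf
        omega
    · rcases mem q with ⟨s', hs', hsq⟩ | ⟨hnq, hq⟩
      · exfalso
        have := hnp s' hs'
        have := rv s' hs' q hsq
        rw [hp] at hf
        omega
      · rw [hp, hq] at hf
        omega

namespace DCExistence

/-- In a bijective rearrangement, an element that is moved one step to the right (among elements
that move by at most one step) is exchanged with its neighbour. -/
theorem swap_neighbour {L : Type*} {N : ℕ} (e e' : L ≃ Fin N) (G : Set L)
    (h1 : ∀ x ∈ G, (e' x : ℕ) ≤ e x + 1 ∧ (e x : ℕ) ≤ e' x + 1)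
    (h2 : ∀ x ∈ G, ∀ y, e y = e' x → y ∈ G) :
    ∀ k : ℕ, ∀ x ∈ G, N ≤ k + e x → (e' x : ℕ) = e x + 1 →
      ∀ y, (e y : ℕ) = e x + 1 → e' y = e x := by
  intro k
  induction k with
  | zero => intro x _ h; have := (e x).2; omega
  | succ k ih =>
    intro x hx hk hxe y hy
    have hyG : y ∈ G := h2 x hx y (Fin.ext (by omega))
    have hyx : (e' y : ℕ) ≠ e' x := by
      intro h
      have : y = x := e'.injective (Fin.ext h)
      subst this
      omega
    have hb := h1 y hyG
    by_cases hup : (e' y : ℕ) = e y + 1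
    · exfalso
      obtain ⟨z, hz⟩ := e.surjective (e' y)
      have hz' : (e z : ℕ) = e y + 1 := by rw [hz]; exact hup
      have := ih y hyG (by omega) hup z hz'
      have hzx : z = x := e'.injective (by rw [this]; exact Fin.ext (by omega))
      subst hzx
      omega
    · exact Fin.ext (by omega)

/-- Distance from the center at time `r` after the own crossing switch. -/
def wv (n A k r : ℤ) : ℤ := A - 1 - k + max 0 (min (n - A) (min r (2 * n - 1 - r) - k))

theorem wv_lt {n A B S R k l r r' : ℤ} (hn : n = A + S + B + R) (hS : 0 ≤ S) (hR : 0 ≤ R)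
    (hk : 0 ≤ k) (hkA : k < A) (hl : 0 ≤ l) (hlB : l < B) (hr : 0 ≤ r) (hr2 : r < 2 * n)
    (hr' : (A + 2 * S + B ≤ r ∧ r' = r - (A + 2 * S + B)) ∨
      (r < A + 2 * S + B ∧ r' = r - (A + 2 * S + B) + 2 * n)) :
    ((r < B + S + k - l ∨ n + A + S + l - k ≤ r) → wv n A k r < wv n B l r') ∧
    (¬ (r < B + S + k - l ∨ n + A + S + l - k ≤ r) → wv n B l r' < wv n A k r) := by
  unfold wv
  subst hn
  rcases hr' with ⟨h, rfl⟩ | ⟨h, rfl⟩ <;> constructor <;> intro h' <;> omega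

/-- Position at time `m` of the element with the given parameters. -/
def ps (n A k δ : ℤ) (s : Bool) (m : ℤ) : ℤ :=
  if ((m - δ - 1) / (2 * n) % 2 = 0 ↔ s = true) then n + wv n A k ((m - δ - 1) % (2 * n))
  else n - 1 - wv n A k ((m - δ - 1) % (2 * n))

theorem divmod {n z q r : ℤ} (h0 : 0 ≤ r) (h1 : r < 2 * n) (hz : z = 2 * n * q + r) :
    z / (2 * n) = q ∧ z % (2 * n) = r := by
  have := (Int.ediv_emod_unique (a := z) (b := 2 * n) (r := r) (q := q) (by omega)).2
    ⟨by linarith, h0, h1⟩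
  exact this

theorem ps_eq {n A k δ m q r : ℤ} {s : Bool} (h0 : 0 ≤ r) (h1 : r < 2 * n)
    (hz : m - δ - 1 = 2 * n * q + r) :
    ps n A k δ s m = if (q % 2 = 0 ↔ s = true) then n + wv n A k r else n - 1 - wv n A k r := by
  obtain ⟨ha, hb⟩ := divmod h0 h1 hz
  simp only [ps, ha, hb]

theorem exists_qr {n : ℤ} (hn : 0 < n) (z : ℤ) : ∃ q r, 0 ≤ r ∧ r < 2 * n ∧ z = 2 * n * q + r :=
  ⟨z / (2 * n), z % (2 * n), Int.emod_nonneg _ (by omega), Int.emod_lt_of_pos _ (by omega),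
    (Int.mul_ediv_add_emod z (2 * n)).symm⟩

theorem wv_bounds {n A k r : ℤ} (hA : A ≤ n) (hk : 0 ≤ k) (hkA : k < A) :
    0 ≤ wv n A k r ∧ wv n A k r < n := by
  unfold wv; omega

theorem ps_bounds {n A k δ m : ℤ} {s : Bool} (hA : A ≤ n) (hk : 0 ≤ k) (hkA : k < A) :
    0 ≤ ps n A k δ s m ∧ ps n A k δ s m < 2 * n := by
  have := wv_bounds (r := (m - δ - 1) % (2 * n)) hA hk hkA
  unfold ps; split_ifs <;> omega

theorem ps_add {n A k δ m : ℤ} {s : Bool} (hn : 0 < n) :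
    ps n A k δ s (m + 2 * n) = 2 * n - 1 - ps n A k δ s m := by
  obtain ⟨q, r, h0, h1, hz⟩ := exists_qr hn (m - δ - 1)
  rw [ps_eq h0 h1 hz, ps_eq (q := q + 1) h0 h1 (by linarith)]
  cases s <;> simp only [Bool.false_eq_true, iff_false, iff_true] <;> split_ifs <;> omega

theorem ps_not {n A k δ m : ℤ} {s : Bool} :
    ps n A k δ (!s) m = 2 * n - 1 - ps n A k δ s m := by
  unfold ps
  cases s <;> simp only [Bool.not_true, Bool.not_false, Bool.false_eq_true, iff_false, iff_true] <;>
    split_ifs <;> omega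

theorem ps_cross {n A k δ m : ℤ} {s : Bool} (hA : A ≤ n) (hk : 0 ≤ k) (hkA : k < A)
    (hm : (m - δ) % (2 * n) = 0) :
    ps n A k δ s (m + 1) = 2 * n - 1 - ps n A k δ s m ∧ n - A ≤ ps n A k δ s m ∧
      ps n A k δ s m < n + A := by
  obtain ⟨q, hq⟩ := Int.dvd_of_emod_eq_zero hm
  rw [ps_eq (q := q) (r := 0) le_rfl (by omega) (by linarith),
    ps_eq (q := q - 1) (r := 2 * n - 1) (by omega) (by omega) (by linarith)]
  have e1 : wv n A k 0 = A - 1 - k := by unfold wv; omega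
  have e2 : wv n A k (2 * n - 1) = A - 1 - k := by unfold wv; omega
  rw [e1, e2]
  cases s <;> simp only [Bool.false_eq_true, iff_false, iff_true] <;> split_ifs <;> omega

/-- Off its own crossing switch a point stays on its side and moves by at most one step. -/
theorem ps_step {n A k δ m : ℤ} {s : Bool} (hA : A ≤ n) (hk : 0 ≤ k) (hkA : k < A)
    (hm : (m - δ) % (2 * n) ≠ 0) :
    (n ≤ ps n A k δ s m ↔ n ≤ ps n A k δ s (m + 1)) ∧
    ps n A k δ s (m + 1) ≤ ps n A k δ s m + 1 ∧ ps n A k δ s m ≤ ps n A k δ s (m + 1) + 1 := by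
  obtain ⟨q, r, h0, h1, hz⟩ := exists_qr (n := n) (by omega) (m - δ - 1)
  have hr : r + 1 < 2 * n := by
    by_contra hc
    apply hm
    have : m - δ = 2 * n * (q + 1) := by linarith
    rw [this]; exact Int.mul_emod_right _ _
  rw [ps_eq h0 h1 hz, ps_eq (q := q) (r := r + 1) (by omega) hr (by linarith)]
  have b1 := wv_bounds (r := r) hA hk hkA
  have b2 := wv_bounds (r := r + 1) hA hk hkA
  have : wv n A k (r + 1) ≤ wv n A k r + 1 ∧ wv n A k r ≤ wv n A k (r + 1) + 1 := by
    unfold wv; omega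
  split_ifs <;> omega

theorem ps_still {n A δ m q r : ℤ} {s : Bool} (hA : A ≤ n) (hA0 : 0 < A)
    (h0 : 0 ≤ r) (h1 : r < 2 * n) (hz : m - δ - 1 = 2 * n * q + r)
    (h : ps n A 0 δ s (m + 1) = ps n A 0 δ s m) : n - A ≤ r ∧ r + 1 ≤ n + A - 1 := by
  rw [ps_eq h0 h1 hz] at h
  by_cases hr : r + 1 < 2 * n
  · rw [ps_eq (q := q) (r := r + 1) (by omega) hr (by linarith)] at h
    have : wv n A 0 (r + 1) = wv n A 0 r := by split_ifs at h <;> omega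
    unfold wv at this
    omega
  · rw [ps_eq (q := q + 1) (r := 0) (by omega) (by omega) (by linarith)] at h
    have b1 := wv_bounds (r := r) hA le_rfl hA0
    have b2 := wv_bounds (r := 0) hA le_rfl hA0
    cases s <;> simp only [Bool.false_eq_true, iff_false, iff_true] at h <;>
      split_ifs at h <;> omega

/-- Two points are never at the same position, and their order changes exactly once per
halfperiod: same crossing substring. -/
theorem flip_same {n A k k' δ : ℤ} {s s' : Bool} (hA : A ≤ n) (hk : 0 ≤ k) (hkA : k < A)
    (hk' : 0 ≤ k') (hkA' : k' < A) (hne : ¬ (k = k' ∧ s = s')) (m : ℤ) :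
    ps n A k δ s m ≠ ps n A k' δ s' m ∧
    ((m - δ) % (2 * n) = 0 ↔ (ps n A k δ s m < ps n A k' δ s' m ↔
      ¬ ps n A k δ s (m + 1) < ps n A k' δ s' (m + 1))) := by
  have hn : 0 < n := by omega
  have key : ∀ r, 0 ≤ r → r < 2 * n → (k < k' → wv n A k' r < wv n A k r) ∧
      (k' < k → wv n A k r < wv n A k' r) ∧ (k = k' → wv n A k r = wv n A k' r) := by
    intro r _ _
    refine ⟨fun h => ?_, fun h => ?_, fun h => by rw [h]⟩ <;> unfold wv <;> omega
  have bd : ∀ r, 0 ≤ wv n A k r ∧ 0 ≤ wv n A k' r := fun r =>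
    ⟨(wv_bounds hA hk hkA).1, (wv_bounds hA hk' hkA').1⟩
  obtain ⟨q, r, h0, h1, hz⟩ := exists_qr hn (m - δ - 1)
  have K := key r h0 h1
  have b := bd r
  by_cases hr : r + 1 < 2 * n
  · have hm : (m - δ) % (2 * n) = r + 1 := (divmod (by omega) hr (q := q) (by linarith)).2
    have K' := key (r + 1) (by omega) hr
    have b' := bd (r + 1)
    rw [hm, ps_eq h0 h1 hz, ps_eq h0 h1 hz, ps_eq (q := q) (r := r + 1) (by omega) hr (by linarith),
      ps_eq (q := q) (r := r + 1) (by omega) hr (by linarith)]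
    cases s <;> cases s' <;>
      simp only [Bool.false_eq_true, iff_false, iff_true, and_true, reduceCtorEq, and_false] at hne ⊢ <;>
      split_ifs <;> omega
  · have hm : (m - δ) % (2 * n) = 0 :=
      (divmod (by omega) (by omega) (q := q + 1) (by linarith)).2
    have K' := key 0 (by omega) (by omega)
    have b' := bd 0
    rw [hm, ps_eq h0 h1 hz, ps_eq h0 h1 hz, ps_eq (q := q + 1) (r := 0) (by omega) (by omega)
      (by linarith), ps_eq (q := q + 1) (r := 0) (by omega) (by omega) (by linarith)]
    cases s <;> cases s' <;>
      simp only [Bool.false_eq_true, iff_false, iff_true, and_true, reduceCtorEq, and_false, true_iff] at hne ⊢ <;>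
      split_ifs <;> omega

/-- The same for points of different crossing substrings. -/
theorem flip_diff {n A B S R k l δ : ℤ} {s s' : Bool} (hn : n = A + S + B + R) (hS : 0 ≤ S)
    (hR : 0 ≤ R) (hk : 0 ≤ k) (hkA : k < A) (hl : 0 ≤ l) (hlB : l < B) (m : ℤ) :
    ps n A k δ s m ≠ ps n B l (δ + (A + 2 * S + B)) s' m ∧
    ((m - (if s = s' then δ + (n + A + S + l - k) else δ + (B + S + k - l))) % (2 * n) = 0 ↔
      (ps n A k δ s m < ps n B l (δ + (A + 2 * S + B)) s' m ↔
      ¬ ps n A k δ s (m + 1) < ps n B l (δ + (A + 2 * S + B)) s' (m + 1))) := by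
  have hn0 : 0 < n := by omega
  have full : ∀ m q r, 0 ≤ r → r < 2 * n → m - δ - 1 = 2 * n * q + r →
      ps n A k δ s m ≠ ps n B l (δ + (A + 2 * S + B)) s' m ∧
      (ps n A k δ s m < ps n B l (δ + (A + 2 * S + B)) s' m ↔
        if s = s' then (if (q % 2 = 0 ↔ s = true) then n + A + S + l - k ≤ r
          else r < n + A + S + l - k)
        else (if (q % 2 = 0 ↔ s = true) then r < B + S + k - l else B + S + k - l ≤ r)) := by
    intro m q r h0 h1 hz
    have b1 := wv_bounds (n := n) (r := r) (by omega : A ≤ n) hk hkA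
    by_cases hD : A + 2 * S + B ≤ r
    · have W := wv_lt hn hS hR hk hkA hl hlB h0 h1 (Or.inl ⟨hD, rfl⟩)
      have b2 := wv_bounds (n := n) (r := r - (A + 2 * S + B)) (by omega : B ≤ n) hl hlB
      rw [ps_eq h0 h1 hz, ps_eq (q := q) (r := r - (A + 2 * S + B)) (by omega) (by omega)
        (by linarith)]
      cases s <;> cases s' <;>
        simp only [Bool.false_eq_true, iff_false, iff_true, if_true, if_false, reduceCtorEq] <;>
        split_ifs <;> omega
    · have W := wv_lt hn hS hR hk hkA hl hlB h0 h1 (Or.inr ⟨by omega, rfl⟩)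
      have b2 := wv_bounds (n := n) (r := r - (A + 2 * S + B) + 2 * n) (by omega : B ≤ n) hl hlB
      rw [ps_eq h0 h1 hz, ps_eq (q := q - 1) (r := r - (A + 2 * S + B) + 2 * n) (by omega)
        (by omega) (by linarith)]
      cases s <;> cases s' <;>
        simp only [Bool.false_eq_true, iff_false, iff_true, if_true, if_false, reduceCtorEq] <;>
        split_ifs <;> omega
  obtain ⟨q, r, h0, h1, hz⟩ := exists_qr hn0 (m - δ - 1)
  obtain ⟨f1, f2⟩ := full m q r h0 h1 hz
  refine ⟨f1, ?_⟩
  set T : ℤ := if s = s' then n + A + S + l - k else B + S + k - l with hT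
  have hT0 : 0 < T ∧ T < 2 * n := by rw [hT]; split_ifs <;> omega
  have hc : (m - (if s = s' then δ + (n + A + S + l - k) else δ + (B + S + k - l))) % (2 * n) = 0 ↔
      r + 1 = T := by
    have e : m - (if s = s' then δ + (n + A + S + l - k) else δ + (B + S + k - l)) =
        2 * n * q + (r + 1 - T) := by
      rw [hT]; split_ifs <;> linarith
    rw [e, Int.mul_add_emod_self_left]
    constructor
    · intro h
      obtain ⟨c, hc⟩ := Int.dvd_of_emod_eq_zero h
      have h3 : c < 1 := by nlinarith
      have h4 : -1 < c := by nlinarith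
      have : c = 0 := by omega
      subst this
      omega
    · intro h
      rw [h]; simp
  rw [hc, f2]
  by_cases hr : r + 1 < 2 * n
  · obtain ⟨_, g2⟩ := full (m + 1) q (r + 1) (by omega) hr (by linarith)
    rw [g2, hT]
    cases s <;> cases s' <;>
      simp only [Bool.false_eq_true, iff_false, iff_true, if_true, if_false, reduceCtorEq] <;>
      split_ifs <;> omega
  · obtain ⟨_, g2⟩ := full (m + 1) (q + 1) 0 (by omega) (by omega) (by linarith)
    rw [g2, hT]
    rw [hT] at hT0
    cases s <;> cases s' <;>
      simp only [Bool.false_eq_true, iff_false, iff_true, if_true, if_false, reduceCtorEq] at hT0 ⊢ <;>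
      split_ifs <;> omega

theorem layout {t : ℕ} (d : Fin t → ℕ) (ht : 0 < t) (hd : ∀ i, 0 < d i) :
    ∃ δ : Fin t → ℤ, δ ⟨0, ht⟩ = 0 ∧ (∀ i, 0 ≤ δ i ∧ δ i < 2 * (∑ j, d j : ℕ)) ∧
      ∀ i j, i < j → ∃ S R : ℤ, 0 ≤ S ∧ 0 ≤ R ∧ ((∑ j, d j : ℕ) : ℤ) = d i + S + d j + R ∧
        δ j = δ i + (d i + 2 * S + d j) := by
  set P : Fin t → ℕ := fun i => ∑ j ∈ Finset.Iio i, d j with hP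
  have h1 : ∀ i j, i < j → P i + d i ≤ P j := by
    intro i j hij
    have : ∑ a ∈ Finset.Iic i, d a = d i + P i := by
      rw [hP, ← Finset.Iio_insert, Finset.sum_insert (by simp)]
    have h2 : ∑ a ∈ Finset.Iic i, d a ≤ P j :=
      Finset.sum_le_sum_of_subset (fun a ha => by
        simp only [Finset.mem_Iic, Finset.mem_Iio] at ha ⊢; exact lt_of_le_of_lt ha hij)
    omega
  have h2 : ∀ j, P j + d j ≤ ∑ j, d j := by
    intro j
    have : ∑ a ∈ Finset.Iic j, d a = d j + P j := by
      rw [hP, ← Finset.Iio_insert, Finset.sum_insert (by simp)]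
    have h2 : ∑ a ∈ Finset.Iic j, d a ≤ ∑ j, d j :=
      Finset.sum_le_sum_of_subset (Finset.subset_univ _)
    omega
  have h0 : P ⟨0, ht⟩ = 0 := by
    rw [hP]
    refine Finset.sum_eq_zero (fun a ha => ?_)
    rw [Finset.mem_Iio, Fin.lt_def] at ha
    exact absurd ha (Nat.not_lt_zero _)
  refine ⟨fun i => 2 * P i + d i - d ⟨0, ht⟩, by simp [h0], fun i => ?_, fun i j hij => ?_⟩
  · have a := h2 i
    have b := hd ⟨0, ht⟩
    have c := hd i
    show 0 ≤ 2 * (P i : ℤ) + d i - d ⟨0, ht⟩ ∧ 2 * (P i : ℤ) + d i - d ⟨0, ht⟩ < 2 * (∑ j, d j : ℕ)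
    rcases eq_or_ne i ⟨0, ht⟩ with rfl | hi
    · constructor <;> omega
    · have := h1 ⟨0, ht⟩ i (by rw [Fin.lt_def]; have := Fin.val_ne_of_ne hi; simp at this ⊢; omega)
      constructor <;> omega
  · have a := h1 i j hij
    have b := h2 j
    exact ⟨(P j : ℤ) - P i - d i, ((∑ j, d j : ℕ) : ℤ) - P j - d j + P i, by omega, by omega,
      by ring, by ring⟩

theorem exists_isDC {t : ℕ} (d : Fin t → ℕ) (ht : 2 ≤ t) (hd : ∀ i, 0 < d i) :
    ∃ A : AllowableSequence (2 * ∑ i, d i), A.IsDC d := by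
  obtain ⟨δ, hδ0, hδb, hδ⟩ := layout d (by omega) hd
  set n : ℕ := ∑ i, d i with hn
  have hi01 : (⟨0, by omega⟩ : Fin t) < ⟨1, by omega⟩ := by rw [Fin.lt_def]; simp
  have hdn : ∀ i, (d i : ℤ) ≤ n := by
    intro i
    exact_mod_cast Finset.single_le_sum (f := d) (fun _ _ => Nat.zero_le _) (Finset.mem_univ i)
  have hn0 : (0 : ℤ) < n := by have := hd ⟨0, by omega⟩; have := hdn ⟨0, by omega⟩; omega
  -- the labels of the points and their positions
  let L := (Σ i : Fin t, Fin (d i)) × Bool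
  let f : ℤ → L → ℤ := fun m x => ps n (d x.1.1) (x.1.2 : ℕ) (δ x.1.1) x.2 m
  have fb : ∀ m x, 0 ≤ f m x ∧ f m x < 2 * n := fun m x =>
    ps_bounds (hdn _) (by omega) (by have := x.1.2.2; omega)
  have flip : ∀ x y : L, x ≠ y → (∀ m, f m x ≠ f m y) ∧ ∃ c : ℤ, ∀ m,
      ((m - c) % (2 * n) = 0 ↔ (f m x < f m y ↔ ¬ f (m + 1) x < f (m + 1) y)) := by
    have lt : ∀ x y : L, x.1.1 < y.1.1 → (∀ m, f m x ≠ f m y) ∧ ∃ c : ℤ, ∀ m,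
      ((m - c) % (2 * n) = 0 ↔ (f m x < f m y ↔ ¬ f (m + 1) x < f (m + 1) y)) := by
      rintro ⟨⟨i, k⟩, s⟩ ⟨⟨j, l⟩, s'⟩ hij
      obtain ⟨S, R, hS, hR, e1, e2⟩ := hδ i j hij
      have F := fun m => flip_diff (δ := δ i) (s := s) (s' := s') (k := (k : ℕ)) (l := (l : ℕ))
        e1 hS hR (by omega) (by have := k.2; omega) (by omega) (by have := l.2; omega) m
      rw [← e2] at F
      exact ⟨fun m => (F m).1, _, fun m => (F m).2⟩
    intro x y hxy
    rcases lt_trichotomy x.1.1 y.1.1 with h | h | h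
    · exact lt x y h
    · obtain ⟨⟨i, k⟩, s⟩ := x
      obtain ⟨⟨j, l⟩, s'⟩ := y
      simp only at h
      subst h
      have F := fun m => flip_same (n := n) (A := d i) (δ := δ i) (s := s) (s' := s') (k := (k : ℕ))
        (k' := (l : ℕ)) (hdn i) (by omega) (by have := k.2; omega) (by omega)
        (by have := l.2; omega) (by
          rintro ⟨h1, h2⟩
          apply hxy
          have : k = l := Fin.ext (by exact_mod_cast h1)
          rw [this, h2]) m
      exact ⟨fun m => (F m).1, _, fun m => (F m).2⟩
    · obtain ⟨h1, c, hc⟩ := lt y x h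
      refine ⟨fun m => (h1 m).symm, c, fun m => ?_⟩
      rw [hc m]
      have := h1 m
      have := h1 (m + 1)
      omega
  let g : ℤ → L → Fin (2 * n) := fun m x => ⟨(f m x).toNat, by have := fb m x; omega⟩
  have gv : ∀ m x, ((g m x : ℕ) : ℤ) = f m x := fun m x => Int.toNat_of_nonneg (fb m x).1
  have ginj : ∀ m, Function.Injective (g m) := by
    intro m x y hxy
    by_contra hne
    exact (flip x y hne).1 m (by rw [← gv, ← gv, hxy])
  have gbij : ∀ m, Function.Bijective (g m) := by
    intro m
    rw [Fintype.bijective_iff_injective_and_card]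
    refine ⟨ginj m, ?_⟩
    simp [L, hn, mul_comm]
  let e : ℤ → L ≃ Fin (2 * n) := fun m => Equiv.ofBijective (g m) (gbij m)
  have ev : ∀ m x, ((e m x : ℕ) : ℤ) = f m x := gv
  let pos : ℤ → Equiv.Perm (Fin (2 * n)) := fun m => (e 0).symm.trans (e m)
  have posv : ∀ m p, ((pos m p : ℕ) : ℤ) = f m ((e 0).symm p) := fun m p => ev m _
  have pose : ∀ m x, pos m (e 0 x) = e m x := fun m x => by simp [pos]
  -- crossing times
  let C : ℤ → Fin t → Prop := fun m i => (m - δ i) % (2 * n) = 0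
  have Cuniq : ∀ m i j, C m i → C m j → i = j := by
    have aux : ∀ m i j, i < j → C m i → ¬ C m j := by
      intro m i j hij h1 h2
      obtain ⟨a, ha⟩ := Int.dvd_of_emod_eq_zero h1
      obtain ⟨b, hb⟩ := Int.dvd_of_emod_eq_zero h2
      obtain ⟨S, R, hS, hR, e1, e2⟩ := hδ i j hij
      have := hd i
      have hi := hδb i
      have hj := hδb j
      have h3 : δ j - δ i = 2 * n * (a - b) := by linarith
      have h4 : 0 < a - b := by
        by_contra hc
        have : (2 * (n : ℤ)) * (a - b) ≤ 0 := mul_nonpos_of_nonneg_of_nonpos (by omega) (by omega)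
        omega
      have h5 : (2 * (n : ℤ)) * 1 ≤ 2 * n * (a - b) :=
        mul_le_mul_of_nonneg_left (by omega) (by omega)
      omega
    intro m i j h1 h2
    rcases lt_trichotomy i j with h | h | h
    · exact absurd h2 (aux m i j h h1)
    · exact h
    · exact absurd h1 (aux m j i h h2)
  have cross_own : ∀ m i, C m i → ∀ x : L, x.1.1 = i → f (m + 1) x = 2 * n - 1 - f m x ∧
      (n : ℤ) - d i ≤ f m x ∧ f m x < n + d i := by
    rintro m i hC ⟨⟨i', k⟩, s⟩ rfl
    exact ps_cross (hdn _) (by omega) (by have := k.2; simp only; omega) hC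
  have step : ∀ m, ∀ x : L, ¬ C m x.1.1 → ((n : ℤ) ≤ f m x ↔ n ≤ f (m + 1) x) ∧
      f (m + 1) x ≤ f m x + 1 ∧ f m x ≤ f (m + 1) x + 1 := by
    rintro m ⟨⟨i', k⟩, s⟩ hC
    exact ps_step (hdn _) (by omega) (by have := k.2; simp only; omega) hC
  -- the points in the crossing block are exactly those of the crossing substring
  have block : ∀ m i, C m i → ∀ m', (m' = m ∨ m' = m + 1) → ∀ x : L,
      ((n : ℤ) - d i ≤ f m' x ∧ f m' x < n + d i) → x.1.1 = i := by
    intro m i hC m' hm' x hx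
    -- counting: the points of the substring fill the block
    let T : Finset L := Finset.univ.filter (fun y => y.1.1 = i)
    let U : Finset (Fin (2 * n)) := Finset.univ.filter
      (fun q => (n : ℤ) - d i ≤ (q : ℕ) ∧ ((q : ℕ) : ℤ) < n + d i)
    have hsub : T.image (e m') ⊆ U := by
      intro q hq
      obtain ⟨y, hy, rfl⟩ := Finset.mem_image.1 hq
      have hy' : y.1.1 = i := (Finset.mem_filter.1 hy).2
      have := cross_own m i hC y hy'
      refine Finset.mem_filter.2 ⟨Finset.mem_univ _, ?_⟩
      rw [ev]
      rcases hm' with rfl | rfl <;> omega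
    have hT : 2 * d i ≤ T.card := by
      let φ : Fin (d i) × Bool → L := fun a => (⟨i, a.1⟩, a.2)
      have hφ : Function.Injective φ := by
        rintro ⟨a, b⟩ ⟨a', b'⟩ h
        cases h
        rfl
      have : (Finset.univ.image φ).card ≤ T.card := Finset.card_le_card (by
        intro y hy
        obtain ⟨a, _, rfl⟩ := Finset.mem_image.1 hy
        exact Finset.mem_filter.2 ⟨Finset.mem_univ _, rfl⟩)
      rw [Finset.card_image_of_injective _ hφ] at this
      simp at this
      omega
    have hU : U.card ≤ 2 * d i := by
      have h1 : (U.map Fin.valEmbedding) ⊆ Finset.Ico (n - d i) (n + d i) := by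
        intro q hq
        obtain ⟨a, ha, rfl⟩ := Finset.mem_map.1 hq
        have := (Finset.mem_filter.1 ha).2
        rw [Finset.mem_Ico]
        simp only [Fin.valEmbedding_apply]
        omega
      have := Finset.card_le_card h1
      rw [Finset.card_map, Nat.card_Ico] at this
      omega
    have hEq : T.image (e m') = U := by
      refine Finset.eq_of_subset_of_card_le hsub ?_
      rw [Finset.card_image_of_injective _ (e m').injective]
      omega
    have : e m' x ∈ U := Finset.mem_filter.2 ⟨Finset.mem_univ _, by rw [ev]; exact hx⟩
    rw [← hEq] at this
    obtain ⟨y, hy, hyx⟩ := Finset.mem_image.1 this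
    rw [← (e m').injective hyx]
    exact (Finset.mem_filter.1 hy).2
  -- the switches
  let G : ℤ → Set L := fun m => {x | ¬ C m x.1.1}
  let W : ℤ → Set (Fin (2 * n) × Fin (2 * n)) := fun m => {s |
    (∃ i, C m i ∧ ((s.1 : ℕ) : ℤ) = n - d i ∧ ((s.2 : ℕ) : ℤ) = n + d i - 1) ∨
    (∃ x ∈ G m, e m x = s.1 ∧ e (m + 1) x = s.2 ∧ (s.2 : ℕ) = s.1 + 1)}
  have g1 : ∀ m, ∀ x ∈ G m, (e (m + 1) x : ℕ) ≤ e m x + 1 ∧ (e m x : ℕ) ≤ e (m + 1) x + 1 := by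
    intro m x hx
    have := step m x hx
    have := ev m x
    have := ev (m + 1) x
    omega
  have g2 : ∀ m, ∀ x ∈ G m, ∀ y, e m y = e (m + 1) x → y ∈ G m := by
    intro m x hx y hy hC
    have h1 := cross_own m _ hC y rfl
    have h2 : f m y = f (m + 1) x := by rw [← ev, ← ev, hy]
    have := block m _ hC (m + 1) (Or.inr rfl) x (by rw [← h2]; exact h1.2)
    exact hx (by rw [this]; exact hC)
  have g3 : ∀ m, ∀ x ∈ G m, ∀ y, e (m + 1) y = e m x → y ∈ G m := by
    intro m x hx y hy hC
    have h1 := cross_own m _ hC y rfl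
    have h2 : f (m + 1) y = f m x := by rw [← ev, ← ev, hy]
    have := block m _ hC m (Or.inl rfl) x (by rw [← h2]; omega)
    exact hx (by rw [this]; exact hC)
  have up : ∀ m, ∀ x ∈ G m, (e (m + 1) x : ℕ) = e m x + 1 → ∀ y, (e m y : ℕ) = e m x + 1 →
      e (m + 1) y = e m x := fun m x hx =>
    swap_neighbour (e m) (e (m + 1)) (G m) (g1 m) (g2 m) (2 * n) x hx (by omega)
  have down : ∀ m, ∀ x ∈ G m, (e m x : ℕ) = e (m + 1) x + 1 →
      ∀ y, (e (m + 1) y : ℕ) = e (m + 1) x + 1 → e m y = e (m + 1) x := fun m x hx =>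
    swap_neighbour (e (m + 1)) (e m) (G m) (fun x hx => (g1 m x hx).symm) (g3 m) (2 * n) x hx
      (by omega)
  -- a point outside all switches does not move
  have fixed : ∀ m x, (∀ s ∈ W m, e m x ∉ Set.Icc s.1 s.2) → e (m + 1) x = e m x := by
    intro m x hx
    by_cases hC : C m x.1.1
    · exfalso
      have h1 := cross_own m _ hC x rfl
      have h2 := hdn x.1.1
      have h3 := hd x.1.1
      have h4 := ev m x
      refine hx (⟨n - d x.1.1, by omega⟩, ⟨n + d x.1.1 - 1, by omega⟩)
        (Or.inl ⟨x.1.1, hC, ?_, ?_⟩) ⟨?_, ?_⟩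
      · simp only; omega
      · simp only; omega
      · rw [Fin.le_def]; simp only; omega
      · rw [Fin.le_def]; simp only; omega
    · by_contra hne
      have hne' : (e (m + 1) x : ℕ) ≠ e m x := fun h => hne (Fin.ext h)
      have h1 := g1 m x hC
      by_cases hu : (e (m + 1) x : ℕ) = e m x + 1
      · refine hx (e m x, e (m + 1) x) (Or.inr ⟨x, hC, rfl, rfl, hu⟩) ⟨le_rfl, ?_⟩
        rw [Fin.le_def]; simp only; omega
      · obtain ⟨y, hy⟩ := (e (m + 1)).surjective (e m x)
        have hyG := g3 m x hC y hy
        have hh := down m x hC (by omega) y (by rw [hy]; omega)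
        refine hx (e (m + 1) x, e m x) (Or.inr ⟨y, hyG, hh, hy, ?_⟩) ⟨?_, le_rfl⟩
        · simp only; omega
        · rw [Fin.le_def]; simp only; omega
  -- members of `W m` as intervals of labels
  have out : ∀ m, ∀ x ∈ G m, ∀ i, C m i → ∀ m', (m' = m ∨ m' = m + 1) →
      f m' x < n - d i ∨ n + d i ≤ f m' x := by
    intro m x hx i hC m' hm'
    by_contra hcon
    have := block m i hC m' hm' x (by omega)
    exact hx (by rw [this]; exact hC)
  have move : ∀ m, IsMove (pos m) (pos (m + 1)) (W m) := by
    intro m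
    have hfix : ∀ p, (∀ s ∈ W m, pos m p ∉ Set.Icc s.1 s.2) → pos (m + 1) p = pos m p :=
      fun p hp => fixed m ((e 0).symm p) hp
    refine ⟨?_, ?_, ?_, ?_, hfix⟩
    · by_contra hemp
      rw [Set.not_nonempty_iff_eq_empty] at hemp
      have hst : ∀ x, f (m + 1) x = f m x := by
        intro x
        rw [← ev, ← ev, fixed m x (by rw [hemp]; simp)]
      obtain ⟨S, R, hS, hR, e1, e2⟩ := hδ _ _ hi01
      have F0 := hst (⟨⟨0, by omega⟩, ⟨0, hd _⟩⟩, true)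
      have F1 := hst (⟨⟨1, by omega⟩, ⟨0, hd _⟩⟩, true)
      have d0 := hd ⟨0, by omega⟩
      have d1 := hd ⟨1, by omega⟩
      have a0 := hdn ⟨0, by omega⟩
      have a1 := hdn ⟨1, by omega⟩
      simp only [f, Nat.cast_zero] at F0 F1
      obtain ⟨q, r, r0, r1, hz⟩ := exists_qr hn0 (m - δ ⟨0, by omega⟩ - 1)
      have K0 := ps_still a0 (by omega) r0 r1 hz F0
      by_cases hD : (d ⟨0, by omega⟩ : ℤ) + 2 * S + d ⟨1, by omega⟩ ≤ r
      · have K1 := ps_still (q := q) (r := r - ((d ⟨0, by omega⟩ : ℤ) + 2 * S + d ⟨1, by omega⟩))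
          a1 (by omega) (by omega) (by omega) (by rw [e2]; linarith) F1
        omega
      · have K1 := ps_still (q := q - 1)
          (r := r - ((d ⟨0, by omega⟩ : ℤ) + 2 * S + d ⟨1, by omega⟩) + 2 * n)
          a1 (by omega) (by omega) (by omega) (by rw [e2]; linarith) F1
        omega
    · rintro s (⟨i, _, h1, h2⟩ | ⟨x, _, _, _, h⟩)
      · have := hd i
        rw [Fin.lt_def]; omega
      · rw [Fin.lt_def]; omega
    · have key : ∀ s ∈ W m, ∀ s' ∈ W m, s ≠ s' → (s.2 : ℕ) < s'.1 ∨ (s'.2 : ℕ) < s.1 := by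
        have bt : ∀ s s' : Fin (2 * n) × Fin (2 * n),
            (∃ i, C m i ∧ ((s.1 : ℕ) : ℤ) = n - d i ∧ ((s.2 : ℕ) : ℤ) = n + d i - 1) →
            (∃ x ∈ G m, e m x = s'.1 ∧ e (m + 1) x = s'.2 ∧ (s'.2 : ℕ) = s'.1 + 1) →
            (s.2 : ℕ) < s'.1 ∨ (s'.2 : ℕ) < s.1 := by
          rintro s s' ⟨i, hC, h1, h2⟩ ⟨x, hx, h3, h4, h5⟩
          have o1 := out m x hx i hC m (Or.inl rfl)
          have o2 := out m x hx i hC (m + 1) (Or.inr rfl)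
          have := hd i
          rw [← ev, h3] at o1
          rw [← ev, h4] at o2
          omega
        rintro s hs s' hs' hne
        rcases hs with hs | hs <;> rcases hs' with hs' | hs'
        · obtain ⟨i, hi, h1, h2⟩ := hs
          obtain ⟨j, hj, h3, h4⟩ := hs'
          have := Cuniq m i j hi hj
          subst this
          exact absurd (Prod.ext (Fin.ext (by omega)) (Fin.ext (by omega))) hne
        · exact bt s s' hs hs'
        · exact (bt s' s hs' hs).symm
        · obtain ⟨x, hx, h1, h2, h3⟩ := hs
          obtain ⟨y, hy, h4, h5, h6⟩ := hs'
          have hne1 : (s.1 : ℕ) ≠ s'.1 := fun h =>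
            hne (Prod.ext (Fin.ext h) (Fin.ext (by omega)))
          have u1 : (s'.1 : ℕ) ≠ s.1 + 1 := by
            intro h
            have := up m x hx (by rw [h1, h2, h3]) y (by rw [h4, h1, h])
            rw [h5, h1] at this
            have := congrArg Fin.val this
            omega
          have u2 : (s.1 : ℕ) ≠ s'.1 + 1 := by
            intro h
            have := up m y hy (by rw [h4, h5, h6]) x (by rw [h4, h1, h])
            rw [h2, h4] at this
            have := congrArg Fin.val this
            omega
          omega
      intro s hs s' hs' hne
      refine Set.disjoint_left.2 (fun a ha ha' => ?_)
      have := key s hs s' hs' hne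
      have b1 := ha.1
      have b2 := ha.2
      have b3 := ha'.1
      have b4 := ha'.2
      rw [Fin.le_def] at b1 b2 b3 b4
      omega
    · rintro s (⟨i, hC, h1, h2⟩ | ⟨x, hx, h1, h2, h3⟩) p ⟨hp1, hp2⟩
      · rw [Fin.le_def] at hp1 hp2
        have a1 := posv m p
        have a2 := posv (m + 1) p
        have hb := block m i hC m (Or.inl rfl) ((e 0).symm p) (by omega)
        have := cross_own m i hC _ hb
        omega
      · rw [Fin.le_def] at hp1 hp2
        have a1 : pos m p = e m ((e 0).symm p) := rfl
        have a2 : pos (m + 1) p = e (m + 1) ((e 0).symm p) := rfl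
        rw [a1] at hp1 hp2
        rw [a1, a2]
        generalize (e 0).symm p = y at *
        by_cases hxy : y = x
        · subst hxy
          rw [h1, h2]; omega
        · have hne : (e m y : ℕ) ≠ e m x := fun h => hxy ((e m).injective (Fin.ext h))
          have hy : (e m y : ℕ) = e m x + 1 := by rw [h1] at hne ⊢; omega
          rw [up m x hx (by rw [h1, h2, h3]) y hy, hy, h1]
          omega
  have crossW : ∀ m i, C m i → ∃ s ∈ W m, IsCrossing s ∧ (s.2 : ℕ) + 1 = (s.1 : ℕ) + 2 * d i := by
    intro m i hC
    have h2 := hdn i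
    have h3 := hd i
    refine ⟨(⟨n - d i, by omega⟩, ⟨n + d i - 1, by omega⟩),
      Or.inl ⟨i, hC, by simp only; omega, by simp only; omega⟩, Fin.ext ?_, ?_⟩
    · rw [Fin.val_rev]; simp only; omega
    · simp only; omega
  have Wcross : ∀ m, ∀ s ∈ W m, IsCrossing s → ∃ i, C m i := by
    rintro m s (⟨i, hC, _⟩ | ⟨x, hx, h1, h2, h3⟩) hs
    · exact ⟨i, hC⟩
    · exfalso
      have h4 := congrArg Fin.val hs
      rw [Fin.val_rev] at h4
      have := step m x hx
      rw [← ev, ← ev, h1, h2] at this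
      omega
  have pe : ∀ i : ℤ, i - 1 + 1 = i := fun i => by ring
  let A : AllowableSequence (2 * n) :=
    { pos := pos
      switches := fun i => W (i - 1)
      h := 2 * n
      h_pos := by omega
      pos_zero := by ext p; simp [pos]
      pos_add_h := by
        intro m p
        apply Fin.ext
        rw [Fin.val_rev]
        have a1 := posv m p
        have a2 := posv (m + (2 * n : ℕ)) p
        have : f (m + (2 * n : ℕ)) ((e 0).symm p) = 2 * n - 1 - f m ((e 0).symm p) := by
          push_cast
          exact ps_add hn0
        omega
      isMove := by
        intro i
        have := move (i - 1)
        rwa [pe] at this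
      existsUnique_switch := by
        intro p q hpq
        have hl : (e 0).symm p ≠ (e 0).symm q := fun h => hpq ((e 0).symm.injective h)
        obtain ⟨_, c, hc⟩ := flip _ _ hl
        have iff : ∀ i : ℤ, (∃ s ∈ W (i - 1), pos (i - 1) p ∈ Set.Icc s.1 s.2 ∧
            pos (i - 1) q ∈ Set.Icc s.1 s.2) ↔ (i - 1 - c) % (2 * n) = 0 := by
          intro i
          rw [(move (i - 1)).flip_iff hpq, hc (i - 1), ← posv, ← posv, ← posv, ← posv]
          simp only [Fin.lt_def, Nat.cast_lt]
        have c0 := Int.emod_nonneg c (b := 2 * (n : ℤ)) (by omega)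
        have c1 := Int.emod_lt_of_pos c (b := 2 * (n : ℤ)) (by omega)
        refine ⟨c % (2 * n) + 1, ⟨⟨by omega, by push_cast; omega⟩, (iff _).2 ?_⟩, ?_⟩
        · have : c % (2 * n) + 1 - 1 - c = 2 * n * (-(c / (2 * n))) := by
            have := Int.mul_ediv_add_emod c (2 * (n : ℤ))
            linarith
          rw [this]
          exact Int.mul_emod_right _ _
        · rintro i ⟨⟨i0, i1⟩, hi⟩
          have h2 : (i - 1) % (2 * n) = c % (2 * n) :=
            Int.emod_eq_emod_iff_emod_sub_eq_zero.2 ((iff i).1 hi)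
          push_cast at i1
          rw [Int.emod_eq_of_lt (by omega) (by omega)] at h2
          omega }
  refine ⟨A, ⟨⟨even_two_mul n, rfl⟩, ?_, ?_, ⟨fun j => δ j + 1, ?_, ?_, ?_⟩, ?_⟩⟩
  · intro p
    refine ⟨e 0 (((e 0).symm p).1, !((e 0).symm p).2), fun i => ?_⟩
    show pos i _ = _
    rw [pose]
    apply Fin.ext
    have a1 := posv i p
    have a2 := ev i (((e 0).symm p).1, !((e 0).symm p).2)
    have a3 : f i (((e 0).symm p).1, !((e 0).symm p).2) = 2 * n - 1 - f i ((e 0).symm p) := ps_not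
    have a4 : A.pos i p = pos i p := rfl
    rw [Fin.val_rev, a4]
    omega
  · rintro i s (⟨j, _, h1, h2⟩ | ⟨_, _, _, _, h⟩)
    · left
      apply Fin.ext
      rw [Fin.val_rev]
      omega
    · exact Or.inr h
  · intro i j hij
    obtain ⟨S, R, hS, hR, e1, e2⟩ := hδ i j hij
    have := hd i
    simp only
    omega
  · intro i
    have hh : (A.h : ℤ) = 2 * n := by simp [A]
    rw [hh]
    constructor
    · rintro ⟨j, rfl⟩
      have := hδb j
      simp only
      refine ⟨by omega, ?_⟩
      obtain ⟨s, hs, hs', _⟩ := crossW (δ j) j (by simp [C])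
      refine ⟨s, ?_, hs'⟩
      show s ∈ W (δ j + 1 - 1)
      rwa [add_sub_cancel_right]
    · rintro ⟨hi, s, hs, hs'⟩
      obtain ⟨j, hj⟩ := Wcross _ s hs hs'
      refine ⟨j, ?_⟩
      have := hδb j
      have h2 : (i - 1) % (2 * n) = δ j % (2 * n) :=
        Int.emod_eq_emod_iff_emod_sub_eq_zero.2 hj
      rw [Int.emod_eq_of_lt (by omega) (by omega), Int.emod_eq_of_lt (by omega) (by omega)] at h2
      simp only
      omega
  · intro j
    obtain ⟨s, hs, hs'⟩ := crossW (δ j) j (by simp [C])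
    refine ⟨s, ?_, hs'⟩
    show s ∈ W (δ j + 1 - 1)
    rwa [add_sub_cancel_right]
  · obtain ⟨s, hs, hs', _⟩ := crossW 0 ⟨0, by omega⟩ (by simp [C, hδ0])
    refine ⟨s, ?_, hs'⟩
    show s ∈ W (1 - 1)
    rwa [sub_self]

end DCExistence

/-- The even-near-critical centrally symmetric allowable sequence in noncentral general position
with central signature `d` whose first move includes a crossing switch, on `2 * ∑ i, d i` points
labelled by their positions in the permutation with index `0`. (It is the only sequence with these
properties; the definition picks one.) -/
noncomputable def DC {t : ℕ} (d : Fin t → ℕ) (ht : 2 ≤ t) (hd : ∀ i, 0 < d i) :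
    AllowableSequence (2 * ∑ i, d i) :=
  (DCExistence.exists_isDC d ht hd).choose

theorem DC_isDC {t : ℕ} (d : Fin t → ℕ) (ht : 2 ≤ t) (hd : ∀ i, 0 < d i) :
    (DC d ht hd).IsDC d :=
  (DCExistence.exists_isDC d ht hd).choose_spec

/-! The conditions `IsDC d` determine the switches explicitly, and then realizability becomes linear
algebra.

Combinatorial half. Only distances from the centre are watched. The points reversed by one crossing
switch form a block; every point belongs to exactly one block, and the points of a block keep the
order of their distances. So a block leaves the centre one point after the other (`outward_bound`).
Hence the crossing switches of two consecutive blocks are at least `d i + d j` moves apart (`gap`);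
around a halfperiod these bounds add up to `2 n`, its length, so all of them are attained
(`time_eq`). The resulting upper bounds for the distances have the same sum as the distances
themselves, so they too are attained, and the positions are those of `ps` (`IsDC.exists_label`).

Geometric half. Points that switch have equal projections at the critical angle, so two pairs that
switch in the same move give parallel difference vectors. For three consecutive blocks of size two,
let a, b, c be the vectors from the conjugate of an outer point to that point; the inner vectors are
multiples of these. Five coincidences force a common ratio α with α² + α = 1, and b = a + c
(`golden_of_cross`). Now αb + c and αa - b are parallel, but they belong to critical directions
whose indices differ by n - 6; so n = 6 (`rigid`), which leaves no room for a fourth block.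
Conjugate pairs share their midpoint (`midpoint_eq`), and the linear map prescribed on a and c
carries the configuration to `Z5_12_6`.

Conversely, twelve points with coordinates in ℤ[α] realize (2,2,2): the orders of their projections
between consecutive critical directions are compared with `ps` in exact arithmetic (`order_check`),
and half turns give the remaining permutations. -/

namespace AllowableSequence

/-! ### Changes of order and their periodicity. -/

section Basic

variable {N : ℕ}

/-- The order of two points changes in the move from permutation `m` to permutation `m + 1`. -/
def Flips (A : AllowableSequence N) (m : ℤ) (p q : Fin N) : Prop :=
  A.pos m p < A.pos m q ↔ ¬ A.pos (m + 1) p < A.pos (m + 1) q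

theorem pos_ne (A : AllowableSequence N) (m : ℤ) {p q : Fin N} (hpq : p ≠ q) :
    (A.pos m p : ℕ) ≠ A.pos m q := fun h => hpq ((A.pos m).injective (Fin.ext h))

theorem isMove_succ (A : AllowableSequence N) (m : ℤ) :
    IsMove (A.pos m) (A.pos (m + 1)) (A.switches (m + 1)) := by
  have := A.isMove (m + 1)
  rwa [add_sub_cancel_right] at this

theorem val_pos_add_h (A : AllowableSequence N) (m : ℤ) (p : Fin N) :
    (A.pos (m + A.h) p : ℕ) + A.pos m p + 1 = N := by
  rw [A.pos_add_h, Fin.val_rev]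
  have := (A.pos m p).2
  omega

theorem flips_add_h (A : AllowableSequence N) (m : ℤ) {p q : Fin N} (hpq : p ≠ q) :
    A.Flips (m + A.h) p q ↔ A.Flips m p q := by
  unfold Flips
  rw [show m + A.h + 1 = m + 1 + A.h by ring]
  simp only [Fin.lt_def]
  have := A.val_pos_add_h m p
  have := A.val_pos_add_h m q
  have := A.val_pos_add_h (m + 1) p
  have := A.val_pos_add_h (m + 1) q
  have := A.pos_ne m hpq
  have := A.pos_ne (m + 1) hpq
  omega

theorem flips_add_mul (A : AllowableSequence N) (m k : ℤ) {p q : Fin N} (hpq : p ≠ q) :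
    A.Flips (m + A.h * k) p q ↔ A.Flips m p q := by
  induction k with
  | zero => simp
  | succ k ih =>
    rw [← ih, ← A.flips_add_h (m + A.h * k) hpq, mul_add, mul_one, add_assoc]
  | pred k ih =>
    rw [← ih, ← A.flips_add_h (m + A.h * (-k - 1)) hpq, mul_sub, mul_one, add_assoc,
      sub_add_cancel]

theorem flips_iff_switch (A : AllowableSequence N) (m : ℤ) {p q : Fin N} (hpq : p ≠ q) :
    A.Flips m p q ↔ ∃ s ∈ A.switches (m + 1),
      A.pos m p ∈ Set.Icc s.1 s.2 ∧ A.pos m q ∈ Set.Icc s.1 s.2 :=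
  ((A.isMove_succ m).flip_iff hpq).symm

/-- The order of two points changes exactly once in a halfperiod. -/
theorem exists_flips_iff (A : AllowableSequence N) {p q : Fin N} (hpq : p ≠ q) :
    ∃ c : ℤ, 0 ≤ c ∧ c < A.h ∧ ∀ m, A.Flips m p q ↔ (m - c) % A.h = 0 := by
  obtain ⟨i, ⟨⟨h0, h1⟩, hs⟩, hu⟩ := A.existsUnique_switch p q hpq
  have hh : (0 : ℤ) < A.h := by exact_mod_cast A.h_pos
  have hi : A.Flips (i - 1) p q := by
    rw [A.flips_iff_switch _ hpq, sub_add_cancel]; exact hs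
  refine ⟨i - 1, by omega, by omega, fun m => ⟨fun hm => ?_, fun hm => ?_⟩⟩
  · have h2 := Int.emod_nonneg m hh.ne'
    have h3 := Int.emod_lt_of_pos m hh
    have h4 : A.Flips (m % A.h) p q := by
      rw [← A.flips_add_mul _ (m / A.h) hpq, Int.emod_add_mul_ediv]; exact hm
    have h5 := hu (m % A.h + 1) ⟨⟨by omega, by omega⟩, by
      rw [add_sub_cancel_right]; exact (A.flips_iff_switch _ hpq).1 h4⟩
    rw [← h5, add_sub_cancel_right, Int.sub_emod, Int.emod_emod, sub_self, Int.zero_emod]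
  · obtain ⟨k, hk⟩ := Int.dvd_of_emod_eq_zero hm
    rw [show m = i - 1 + A.h * k by linarith, A.flips_add_mul _ _ hpq]
    exact hi

end Basic

/-! ### The sequence seen from the centre. -/

/-- Distance of a position from the centre. -/
def centreDist (n : ℕ) (a : ℕ) : ℤ := if n ≤ a then (a : ℤ) - n else (n : ℤ) - 1 - a

/-- Reversals of disjoint intervals act on the positions as an involution. -/
theorem IsMove.involutive {N : ℕ} {σ τ : Equiv.Perm (Fin N)} {S : Set (Fin N × Fin N)}
    (H : IsMove σ τ S) {p q : Fin N} (h : τ p = σ q) : τ q = σ p := by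
  by_cases hp : ∃ s ∈ S, σ p ∈ Set.Icc s.1 s.2
  · obtain ⟨s, hs, hps⟩ := hp
    have h1 := H.reverse s hs p hps
    have hq : σ q ∈ Set.Icc s.1 s.2 := by
      rw [← h]
      obtain ⟨ha, hb⟩ := hps
      rw [Fin.le_def] at ha hb
      constructor <;> rw [Fin.le_def] <;> omega
    have h2 := H.reverse s hs q hq
    rw [← h] at h2
    exact Fin.ext (by omega)
  · push Not at hp
    have h1 := H.fixed p hp
    have : p = q := σ.injective (h1.symm.trans h)
    rw [← this, h1]

/-- The behaviour of a centrally symmetric sequence in noncentral general position seen from the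
centre. The crossing switches are those of the moves from permutation `μ j` to `μ j + 1`, and the
point `p` takes part in the one with index `b p`. -/
structure CentralDynamics {n t : ℕ} (A : AllowableSequence (2 * n)) (d : Fin t → ℕ) (μ : Fin t → ℤ)
    (b : Fin (2 * n) → Fin t) : Prop where
  h_eq : A.h = 2 * n
  step : ∀ m p, centreDist n (A.pos (m + 1) p) ≤ centreDist n (A.pos m p) + 1 ∧
    centreDist n (A.pos m p) ≤ centreDist n (A.pos (m + 1) p) + 1
  involutive : ∀ m p q, centreDist n (A.pos (m + 1) p) = centreDist n (A.pos m q) →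
    centreDist n (A.pos (m + 1) q) = centreDist n (A.pos m p)
  order : ∀ m p q, b p = b q → (centreDist n (A.pos m p) < centreDist n (A.pos m q) ↔
    centreDist n (A.pos (m + 1) p) < centreDist n (A.pos (m + 1) q))
  mono : StrictMono μ
  bounds : ∀ j, 0 ≤ μ j ∧ μ j < 2 * n
  first : ∃ j, μ j = 0
  block : ∀ j p, b p = j ↔ centreDist n (A.pos (μ j) p) < d j
  cross : ∀ p, centreDist n (A.pos (μ (b p) + 1) p) = centreDist n (A.pos (μ (b p)) p)
  side : ∀ p m, (n ≤ (A.pos m p : ℕ) ↔ ¬ n ≤ (A.pos (m + 1) p : ℕ)) ↔ (m - μ (b p)) % (2 * n) = 0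

/-- A noncrossing switch is a transposition, and the transposition of the two middle positions would
be centered. So only crossing switches carry points from one half to the other. -/
theorem move_cases {n : ℕ} {A : AllowableSequence (2 * n)} (hg : A.IsNoncentralGeneral) (m : ℤ)
    (p : Fin (2 * n)) :
    (∃ s ∈ A.switches (m + 1), IsCrossing s ∧ A.pos m p ∈ Set.Icc s.1 s.2 ∧
      (A.pos (m + 1) p : ℕ) + A.pos m p + 1 = 2 * n) ∨
    ((∀ s ∈ A.switches (m + 1), IsCrossing s → A.pos m p ∉ Set.Icc s.1 s.2) ∧
      (n ≤ (A.pos m p : ℕ) ↔ n ≤ (A.pos (m + 1) p : ℕ)) ∧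
      (A.pos (m + 1) p : ℕ) ≤ A.pos m p + 1 ∧ (A.pos m p : ℕ) ≤ A.pos (m + 1) p + 1) := by
  have H := A.isMove_succ m
  by_cases hc : ∃ s ∈ A.switches (m + 1), IsCrossing s ∧ A.pos m p ∈ Set.Icc s.1 s.2
  · obtain ⟨s, hs, hcs, hp⟩ := hc
    refine Or.inl ⟨s, hs, hcs, hp, ?_⟩
    have h1 := H.reverse s hs p hp
    have h2 : (s.2 : ℕ) = 2 * n - (s.1 + 1) := by rw [hcs, Fin.val_rev]
    have := s.1.2
    omega
  · push Not at hc
    refine Or.inr ⟨hc, ?_⟩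
    by_cases hp : ∃ s ∈ A.switches (m + 1), A.pos m p ∈ Set.Icc s.1 s.2
    · obtain ⟨s, hs, hp⟩ := hp
      have hn : ¬ IsCrossing s := fun h => hc s hs h hp
      have h1 := H.reverse s hs p hp
      have h2 := (hg _ s hs).resolve_left hn
      obtain ⟨ha, hb⟩ := hp
      rw [Fin.le_def] at ha hb
      have h3 : (s.1 : ℕ) + 1 ≠ n := by
        intro h
        apply hn
        apply Fin.ext
        rw [Fin.val_rev]
        omega
      omega
    · push Not at hp
      rw [H.fixed p hp]
      omega

variable {n t : ℕ} {A : AllowableSequence (2 * n)} {d : Fin t → ℕ}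

theorem exists_conj (hA : A.IsCentrallySymmetric) :
    ∃ conj : Fin (2 * n) → Fin (2 * n), ∀ m p, (A.pos m (conj p) : ℕ) + A.pos m p + 1 = 2 * n := by
  choose conj h using hA
  refine ⟨conj, fun m p => ?_⟩
  rw [h, Fin.val_rev]
  have := (A.pos m p).2
  omega

/-- The block of a point is read off from the one move per halfperiod in which the point is
exchanged with its conjugate. Two points of a block flip in its crossing switch, hence in no other
move of the halfperiod, and that switch preserves distances. -/
theorem exists_centralDynamics (hA : A.IsDC d) :
    ∃ μ b, CentralDynamics A d μ b := by
  obtain ⟨conj, hconj⟩ := exists_conj hA.centrallySymmetric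
  have hg := hA.noncentralGeneral
  have hh : A.h = 2 * n := hA.evenNearCritical.2
  obtain ⟨ν, hmono, hran, hsize⟩ := hA.centralSignature
  have hne : ∀ p, p ≠ conj p := fun p h => by
    have := hconj 0 p
    rw [← h] at this
    omega
  -- The move `ν j` starts from permutation `ν j - 1`, and this starting index serves as crossing
  -- time.
  have hbd : ∀ j, 0 ≤ ν j - 1 ∧ ν j - 1 < 2 * n := fun j => by
    have := ((hran (ν j)).1 ⟨j, rfl⟩).1
    rw [hh] at this
    push_cast at this
    omega
  have hf : ∀ m p, (n ≤ (A.pos m p : ℕ) ↔ ¬ n ≤ (A.pos (m + 1) p : ℕ)) ↔ A.Flips m p (conj p) := by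
    intro m p
    unfold Flips
    simp only [Fin.lt_def]
    have := hconj m p
    have := hconj (m + 1) p
    omega
  have hside : ∀ p, ∃ j, ∀ m, (n ≤ (A.pos m p : ℕ) ↔ ¬ n ≤ (A.pos (m + 1) p : ℕ)) ↔
      (m - (ν j - 1)) % (2 * n) = 0 := by
    intro p
    obtain ⟨c, h0, h1, hc⟩ := A.exists_flips_iff (hne p)
    have h2 := (hc c).2 (by simp)
    rw [← hf] at h2
    have h3 : c + 1 ∈ Set.range ν := by
      rw [hran]
      refine ⟨by omega, ?_⟩
      rcases move_cases hg c p with ⟨s, hs, hs', _⟩ | ⟨_, h, _⟩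
      · exact ⟨s, hs, hs'⟩
      · exact absurd h2 (by tauto)
    obtain ⟨j, hj⟩ := h3
    refine ⟨j, fun m => ?_⟩
    rw [hf, hc, hj, hh, add_sub_cancel_right]
    push_cast
    rfl
  choose b hb using hside
  have hW : ∀ m p, (A.pos (m + 1) p : ℕ) + A.pos m p + 1 = 2 * n →
      centreDist n (A.pos (m + 1) p) = centreDist n (A.pos m p) := by
    intro m p h
    unfold centreDist
    split_ifs <;> omega
  -- the crossing switch of its move
  have hcs : ∀ j, ∀ s ∈ A.switches (ν j - 1 + 1), IsCrossing s →
      (s.1 : ℕ) + d j = n ∧ (s.2 : ℕ) + 1 = n + d j := by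
    intro j s hs hc
    obtain ⟨s', hs', hc', he⟩ := hsize j
    rw [sub_add_cancel] at hs
    have lt : ∀ s ∈ A.switches (ν j), IsCrossing s → (s.1 : ℕ) < n ∧ (s.2 : ℕ) + s.1 + 1 = 2 * n := by
      intro s hs hc
      have h1 := (A.isMove (ν j)).lt s hs
      have h2 : (s.2 : ℕ) = 2 * n - (s.1 + 1) := by rw [hc, Fin.val_rev]
      rw [Fin.lt_def] at h1
      have := s.1.2
      omega
    have l1 := lt s hs hc
    have l2 := lt s' hs' hc'
    -- Both centered substrings contain position `n`, so disjointness identifies them.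
    have : s = s' := by
      by_contra hn
      have hdis := Set.disjoint_left.1 ((A.isMove (ν j)).disjoint hs hs' hn)
      have hdis := @hdis ⟨n, by have := s.1.2; omega⟩
      simp only [Set.mem_Icc, Fin.le_def] at hdis
      omega
    subst this
    omega
  have hin : ∀ j p, (n ≤ (A.pos (ν j - 1) p : ℕ) ↔ ¬ n ≤ (A.pos (ν j - 1 + 1) p : ℕ)) ↔
      centreDist n (A.pos (ν j - 1) p) < d j := by
    intro j p
    rcases move_cases hg (ν j - 1) p with ⟨s, hs, hc, hp, he⟩ | ⟨h, h2, _⟩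
    · have := hcs j s hs hc
      obtain ⟨hp1, hp2⟩ := hp
      rw [Fin.le_def] at hp1 hp2
      unfold centreDist
      split_ifs <;> omega
    · obtain ⟨s, hs, hc, he⟩ := hsize j
      rw [← sub_add_cancel (ν j) 1] at hs
      have h3 := hcs j s hs hc
      have h4 := h s hs hc
      have : ¬ centreDist n (A.pos (ν j - 1) p) < d j := by
        intro h5
        apply h4
        unfold centreDist at h5
        constructor <;> rw [Fin.le_def] <;> split_ifs at h5 <;> omega
      tauto
  have hcross : ∀ m p, (m - (ν (b p) - 1)) % (2 * n) = 0 →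
      (A.pos (m + 1) p : ℕ) + A.pos m p + 1 = 2 * n := by
    intro m p h
    rcases move_cases hg m p with ⟨s, hs, hc, hp, he⟩ | ⟨_, h2, _⟩
    · exact he
    · have := (hb p m).2 h
      tauto
  have hblock : ∀ j p, b p = j ↔ centreDist n (A.pos (ν j - 1) p) < d j := by
    intro j p
    rw [← hin, hb]
    constructor
    · rintro rfl; simp
    · intro h
      obtain ⟨k, hk⟩ := Int.dvd_of_emod_eq_zero h
      have h1 := hbd j
      have h2 := hbd (b p)
      have h3 : k < 1 := by nlinarith
      have h4 : -1 < k := by nlinarith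
      have : k = 0 := by omega
      subst this
      exact hmono.injective (by omega)
  have hstep : ∀ m p, centreDist n (A.pos (m + 1) p) ≤ centreDist n (A.pos m p) + 1 ∧
      centreDist n (A.pos m p) ≤ centreDist n (A.pos (m + 1) p) + 1 := by
    intro m p
    rcases move_cases hg m p with ⟨s, hs, hc, hp, he⟩ | ⟨_, h2, _⟩
    · rw [hW m p he]; omega
    · unfold centreDist; split_ifs <;> omega
  have hinv : ∀ m p q, centreDist n (A.pos (m + 1) p) = centreDist n (A.pos m q) →
      centreDist n (A.pos (m + 1) q) = centreDist n (A.pos m p) := by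
    intro m p q h
    have : (A.pos (m + 1) p : ℕ) = A.pos m q ∨ (A.pos (m + 1) p : ℕ) = A.pos m (conj q) := by
      have := hconj m q
      unfold centreDist at h
      split_ifs at h <;> omega
    rcases this with h | h
    · rw [IsMove.involutive (A.isMove_succ m) (Fin.ext h)]
    · rw [← IsMove.involutive (A.isMove_succ m) (Fin.ext h)]
      have := hconj (m + 1) q
      unfold centreDist
      split_ifs <;> omega
  refine ⟨fun j => ν j - 1, b, hh, hstep, hinv, ?_, ?_, hbd, ?_, hblock, ?_, fun p m => hb p m⟩
  · have key : ∀ m p q, b p = b q → centreDist n (A.pos m p) < centreDist n (A.pos m q) →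
        centreDist n (A.pos (m + 1) q) ≤ centreDist n (A.pos (m + 1) p) → False := by
      intro m p q hpq h1 h2
      have hp := hstep m p
      have hq := hstep m q
      by_cases hm : (m - (ν (b p) - 1)) % (2 * n) = 0
      · have e1 := hW m p (hcross m p hm)
        have e2 := hW m q (hcross m q (hpq ▸ hm))
        omega
      -- Flips within a block all have the residue of its crossing move. In any other move `p` keeps
      -- its order relative to `q` and to the conjugate of `q`; since no side changes either, the
      -- order of the distances is kept.
      · have noflip : ∀ u v, u ≠ v → b u = b p → b v = b p → ¬ A.Flips m u v := by
          intro u v huv hu hv hfl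
          obtain ⟨c, _, _, hc⟩ := A.exists_flips_iff huv
          have h4 : A.Flips (ν (b p) - 1) u v := by
            rw [A.flips_iff_switch _ huv]
            obtain ⟨s, hs, hsc, he⟩ := hsize (b p)
            rw [← sub_add_cancel (ν (b p)) 1] at hs
            have h3 := hcs _ s hs hsc
            have hu' := (hblock _ u).1 hu
            have hv' := (hblock _ v).1 hv
            unfold centreDist at hu' hv'
            refine ⟨s, hs, ⟨?_, ?_⟩, ⟨?_, ?_⟩⟩ <;> rw [Fin.le_def] <;>
              split_ifs at hu' hv' <;> omega
          apply hm
          have h5 := (hc _).1 h4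
          have h6 := (hc _).1 hfl
          rw [hh] at h5 h6
          push_cast at h5 h6
          have := Int.sub_emod (m - c) (ν (b p) - 1 - c) (2 * n)
          rw [h5, h6] at this
          simpa using this
        have hbc : b (conj q) = b p := by
          rw [hblock, show centreDist n (A.pos (ν (b p) - 1) (conj q)) =
            centreDist n (A.pos (ν (b p) - 1) q) by
              have := hconj (ν (b p) - 1) q
              unfold centreDist; split_ifs <;> omega]
          exact (hblock _ q).1 hpq.symm
        have sp := mt (hb p m).1 hm
        have sq := mt (hb q m).1 (hpq ▸ hm)
        have npq : p ≠ q := by rintro rfl; omega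
        have npc : p ≠ conj q := by
          intro h
          have := hconj m q
          rw [← h] at this
          unfold centreDist at h1
          split_ifs at h1 <;> omega
        have f1 := noflip p q npq rfl hpq.symm
        have f2 := noflip p (conj q) npc rfl hbc
        have c1 := hconj m q
        have c2 := hconj (m + 1) q
        have i1 := hinv m p q
        have d1 := A.pos_ne m npq
        have d2 := A.pos_ne (m + 1) npq
        have d3 := A.pos_ne m npc
        have d4 := A.pos_ne (m + 1) npc
        unfold Flips at f1 f2
        simp only [Fin.lt_def] at f1 f2
        unfold centreDist at h1 h2
        split_ifs at h1 h2 <;> omega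
    intro m p q hpq
    constructor
    · intro h
      by_contra h2
      exact key m p q hpq h (by omega)
    · intro h
      by_contra h2
      rcases lt_or_eq_of_le (not_lt.1 h2) with h3 | h3
      · exact key m q p hpq.symm h3 h.le
      · have : q = p ∨ q = conj p := by
          have := hconj m p
          have h4 : (A.pos m q : ℕ) = A.pos m p ∨ (A.pos m q : ℕ) = A.pos m (conj p) := by
            unfold centreDist at h3
            split_ifs at h3 <;> omega
          exact h4.imp (fun h => (A.pos m).injective (Fin.ext h))
            (fun h => (A.pos m).injective (Fin.ext h))
        rcases this with rfl | rfl
        · omega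
        · have := hconj (m + 1) p
          unfold centreDist at h
          split_ifs at h <;> omega
  · intro i j hij
    have := hmono hij
    simp only
    omega
  · obtain ⟨s, hs, hc⟩ := hA.first
    have h1 : (0 : ℤ) < A.h := by exact_mod_cast A.h_pos
    obtain ⟨j, hj⟩ := (hran 1).2 ⟨⟨by norm_num, by omega⟩, s, hs, hc⟩
    exact ⟨j, by simp [hj]⟩
  · intro p
    exact hW _ p (hcross _ p (by simp))

end AllowableSequence

/-! ### Uniqueness: crossing times and positions are forced. -/

/-- In a sequence of permutations which change by involutions with steps of at most one, a block of
points which keeps its order and starts at the heights `0, …, D - 1` can only move outward one point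
after the other. -/
theorem outward_bound {L : Type*} (w : ℕ → L → ℤ) (Q : L → Prop) (D : ℤ)
    (step : ∀ m p, w (m + 1) p ≤ w m p + 1)
    (inv : ∀ m p q, w (m + 1) p = w m q → w (m + 1) q = w m p)
    (ord : ∀ m p q, Q p → Q q → w 0 p < w 0 q → w m p < w m q)
    (hD : ∀ p, Q p → w 0 p < D) (h0 : ∀ p, 0 ≤ w 0 p)
    (fill : ∀ a, 0 ≤ a → a < D → ∃ p, Q p ∧ w 0 p = a) (r : ℕ) :
    ∀ p, Q p → w r p ≤ w 0 p + max 0 (r - (D - 1 - w 0 p)) := by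
  induction r with
  | zero => intro p hp; have := hD p hp; push_cast; omega
  | succ r ih =>
    intro p hp
    by_contra hcon
    have h1 := ih p hp
    have h2 := step r p
    have h3 := hD p hp
    have h4 := h0 p
    push_cast at hcon
    obtain ⟨q, hq, hqe⟩ := fill (w 0 p + 1) (by omega) (by omega)
    have h5 := ih q hq
    have h6 := ord r p q hp hq (by omega)
    have h7 := ord (r + 1) p q hp hq (by omega)
    have h8 := inv r p q (by omega)
    omega

namespace AllowableSequence

/-- The sum of the entries of `d` before index `k`. -/
def prefixSum {t : ℕ} (d : Fin t → ℕ) (k : ℕ) : ℕ :=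
  ∑ i ∈ Finset.range k, if h : i < t then d ⟨i, h⟩ else 0

theorem prefixSum_succ {t : ℕ} (d : Fin t → ℕ) (i : Fin t) :
    prefixSum d (i + 1) = prefixSum d i + d i := by
  simp [prefixSum, Finset.sum_range_succ]

theorem prefixSum_zero {t : ℕ} (d : Fin t → ℕ) : prefixSum d 0 = 0 := rfl

theorem prefixSum_self {t : ℕ} (d : Fin t → ℕ) : prefixSum d t = ∑ i, d i :=
  (Finset.sum_fin_eq_sum_range d).symm

theorem prefixSum_mono {t : ℕ} (d : Fin t → ℕ) : Monotone (prefixSum d) :=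
  monotone_nat_of_le_succ fun k => by
    unfold prefixSum; rw [Finset.sum_range_succ]; omega

/-- The number of moves before the crossing switch with index `i`, if the crossing switch with
index `0` takes place in the first move. -/
def blockTime {t : ℕ} [NeZero t] (d : Fin t → ℕ) (i : Fin t) : ℤ :=
  2 * prefixSum d i + d i - d 0

theorem blockTime_lt {t : ℕ} [NeZero t] (d : Fin t → ℕ) {i j : Fin t} (hij : i < j) :
    ∃ S R : ℤ, 0 ≤ S ∧ 0 ≤ R ∧ ((∑ j, d j : ℕ) : ℤ) = d i + S + d j + R ∧
      blockTime d j = blockTime d i + (d i + 2 * S + d j) := by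
  have h1 := prefixSum_succ d i
  have h2 := prefixSum_succ d j
  have h3 : prefixSum d (i + 1) ≤ prefixSum d j := prefixSum_mono d hij
  have h4 : prefixSum d (j + 1) ≤ prefixSum d t := prefixSum_mono d j.2
  rw [prefixSum_self] at h4
  refine ⟨(prefixSum d j : ℤ) - prefixSum d i - d i,
    ((∑ j, d j : ℕ) : ℤ) - prefixSum d j - d j + prefixSum d i, by omega, by omega, by ring, ?_⟩
  unfold blockTime
  ring

theorem centreDist_nonneg (n : ℕ) (a : Fin (2 * n)) : 0 ≤ centreDist n a := by
  have := a.2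
  unfold centreDist; split_ifs <;> omega

theorem centreDist_lt {n : ℕ} (a : Fin (2 * n)) : centreDist n a < n := by
  have := a.2
  unfold centreDist; split_ifs <;> omega

namespace CentralDynamics

open DCExistence

variable {n t : ℕ} {A : AllowableSequence (2 * n)} {d : Fin t → ℕ} {μ : Fin t → ℤ}
  {b : Fin (2 * n) → Fin t} (H : CentralDynamics A d μ b)

theorem exists_centreDist_eq (A : AllowableSequence (2 * n)) (m a : ℤ) (h0 : 0 ≤ a) (h1 : a < n) :
    ∃ p, centreDist n (A.pos m p) = a := by
  obtain ⟨p, hp⟩ := (A.pos m).surjective ⟨n + a.toNat, by omega⟩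
  refine ⟨p, ?_⟩
  rw [hp]
  unfold centreDist
  simp only
  split_ifs <;> omega

include H

theorem periodic (m : ℤ) (p) :
    centreDist n (A.pos (m + 2 * n) p) = centreDist n (A.pos m p) := by
  have := A.val_pos_add_h m p
  rw [H.h_eq] at this
  push_cast at this
  unfold centreDist
  split_ifs <;> omega

theorem order_add {p q} (hpq : b p = b q) (m k : ℤ) :
    centreDist n (A.pos (m + k) p) < centreDist n (A.pos (m + k) q) ↔
      centreDist n (A.pos m p) < centreDist n (A.pos m q) := by
  induction k with
  | zero => simp
  | succ k ih => rw [← ih, ← add_assoc, ← H.order _ p q hpq]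
  | pred k ih => rw [← ih, H.order _ p q hpq, add_assoc, sub_add_cancel]

theorem order_iff {p q} (hpq : b p = b q) (m m' : ℤ) :
    centreDist n (A.pos m p) < centreDist n (A.pos m q) ↔
      centreDist n (A.pos m' p) < centreDist n (A.pos m' q) := by
  rw [← H.order_add hpq m (m' - m), add_sub_cancel]

/-- The crossing switch preserves distances, so right after it the block again fills the heights
below its size and `outward_bound` applies. -/
theorem forward (hdn : ∀ i, d i ≤ n) (p) (r : ℕ) :
    centreDist n (A.pos (μ (b p) + 1 + r) p) ≤ centreDist n (A.pos (μ (b p)) p) +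
      max 0 (r - (d (b p) - 1 - centreDist n (A.pos (μ (b p)) p))) := by
  have := outward_bound (fun r q => centreDist n (A.pos (μ (b p) + 1 + (r : ℕ)) q))
    (fun q => b q = b p) (d (b p))
    (fun m q => by
      have := (H.step (μ (b p) + 1 + m) q).1
      push_cast
      rwa [← add_assoc])
    (fun m q q' h => by
      have := H.involutive (μ (b p) + 1 + m) q q'
      push_cast at h ⊢
      rw [← add_assoc] at h ⊢
      exact this h)
    (fun m q q' h h' hlt => (H.order_iff (h.trans h'.symm) _ _).1 hlt)
    (fun q h => by
      have := H.cross q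
      have := (H.block (b p) q).1 h
      rw [← h] at this ⊢
      simp only [Nat.cast_zero, add_zero]
      omega)
    (fun q => centreDist_nonneg n _)
    (fun a h0 h1 => by
      obtain ⟨q, hq⟩ := exists_centreDist_eq A (μ (b p)) a h0
        (by have := hdn (b p); omega)
      have hb : b q = b p := (H.block _ _).2 (by omega)
      refine ⟨q, hb, ?_⟩
      have := H.cross q
      rw [hb] at this
      simp only [Nat.cast_zero, add_zero]
      omega) r p rfl
  simp only [Nat.cast_zero, add_zero] at this
  rwa [H.cross p] at this

/-- The hypotheses of `outward_bound` are invariant under reversal of time; here counting starts at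
the permutation just before the crossing switch. -/
theorem backward (hdn : ∀ i, d i ≤ n) (p) (r : ℕ) :
    centreDist n (A.pos (μ (b p) - r) p) ≤ centreDist n (A.pos (μ (b p)) p) +
      max 0 (r - (d (b p) - 1 - centreDist n (A.pos (μ (b p)) p))) := by
  have := outward_bound (fun r q => centreDist n (A.pos (μ (b p) - (r : ℕ)) q))
    (fun q => b q = b p) (d (b p))
    (fun m q => by
      have := (H.step (μ (b p) - (m + 1)) q).2
      push_cast
      rwa [← sub_sub, sub_add_cancel, sub_sub] at this)
    (fun m q q' h => by
      have := H.involutive (μ (b p) - (m + 1)) q' q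
      push_cast at h ⊢
      rw [← sub_sub, sub_add_cancel, sub_sub] at this
      exact (this h.symm).symm)
    (fun m q q' h h' hlt => (H.order_iff (h.trans h'.symm) _ _).1 hlt)
    (fun q h => by
      have := (H.block (b p) q).1 h
      simpa using this)
    (fun q => centreDist_nonneg n _)
    (fun a h0 h1 => by
      obtain ⟨q, hq⟩ := exists_centreDist_eq A (μ (b p)) a h0
        (by have := hdn (b p); omega)
      exact ⟨q, (H.block _ _).2 (by omega), by simpa using hq⟩) r p rfl
  simpa using this

/-- The innermost point of block `i` rests at the centre for `d i - 1` moves after its crossing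
switch, and it must have reached distance `d j` when block `j` crosses. -/
theorem gap (hdn : ∀ i, d i ≤ n) (hd : ∀ i, 0 < d i) {i j : Fin t} (hij : i ≠ j) (m : ℤ)
    (hm : m = μ j ∨ m = μ j + 2 * n) (hlt : μ i < m) : μ i + d i + d j ≤ m := by
  have h1 := hd i
  have h2 := hd j
  obtain ⟨p, hp⟩ := exists_centreDist_eq A (μ i) 0 le_rfl (by have := hdn i; omega)
  have hb : b p = i := (H.block _ _).2 (by omega)
  have h3 : ¬ centreDist n (A.pos m p) < d j := by
    have : ¬ centreDist n (A.pos (μ j) p) < d j := fun h =>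
      hij (hb.symm.trans ((H.block _ _).2 h))
    rcases hm with rfl | rfl
    · exact this
    · rwa [H.periodic]
  obtain ⟨r, hr⟩ := Int.le.dest (show μ i + 1 ≤ m by omega)
  have h4 := H.forward hdn p r
  rw [hb, hp, hr] at h4
  omega

/-- The minimal gaps around a halfperiod add up to `2 * ∑ i, d i = 2 * n`. This is the length of the
halfperiod, so no gap can exceed its minimum. -/
theorem time_eq [NeZero t] (hn : n = ∑ i, d i) (hd : ∀ i, 0 < d i) (ht : 2 ≤ t) (j : Fin t) :
    μ j = blockTime d j := by
  have hdn : ∀ i, d i ≤ n := fun i => by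
    rw [hn]; exact Finset.single_le_sum (f := d) (fun _ _ => Nat.zero_le _) (Finset.mem_univ i)
  have h0 : μ 0 = 0 := by
    obtain ⟨j, hj⟩ := H.first
    have := H.mono.monotone (Fin.zero_le j)
    have := (H.bounds 0).1
    omega
  have key : ∀ k l : ℕ, k ≤ l → ∀ (hk : k < t) (hl : l < t),
      2 * (prefixSum d l : ℤ) + d ⟨l, hl⟩ - (2 * prefixSum d k + d ⟨k, hk⟩) ≤
        μ ⟨l, hl⟩ - μ ⟨k, hk⟩ := by
    intro k l hkl hk
    induction l, hkl using Nat.le_induction with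
    | base => intro _; simp
    | succ l hkl ih =>
      intro hl
      have h1 := ih (by omega)
      have h2 := prefixSum_succ d ⟨l, by omega⟩
      have h3 := H.gap hdn hd (i := ⟨l, by omega⟩) (j := ⟨l + 1, hl⟩) (by simp) _ (Or.inl rfl)
        (H.mono (by simp [Fin.lt_def]))
      simp only at h2
      omega
  have h1 := key 0 j (Nat.zero_le _) (by omega) j.2
  have h2 := key j (t - 1) (by omega) j.2 (by omega)
  -- The gap that closes the cycle, from the last block to the first one in the next halfperiod.
  have h3 := H.gap hdn hd (i := ⟨t - 1, by omega⟩) (j := 0)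
    (by rw [Ne, Fin.ext_iff]; simp; omega) _ (Or.inr rfl)
    (by have := (H.bounds ⟨t - 1, by omega⟩).2; omega)
  have h4 := prefixSum_succ d ⟨t - 1, by omega⟩
  have h5 := prefixSum_self d
  simp only [Nat.sub_add_cancel (show 1 ≤ t by omega)] at h4
  have h6 : (⟨0, by omega⟩ : Fin t) = 0 := rfl
  rw [h6] at h1
  rw [prefixSum_zero] at h1
  unfold blockTime
  simp only [Fin.eta] at h1 h2
  omega

/-- The points further out in the block always stay further out and need room below `n`; the
induction runs over their number. -/
theorem le_height (hdn : ∀ i, d i ≤ n) (p) (m : ℤ) : centreDist n (A.pos m p) ≤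
    n - d (b p) + centreDist n (A.pos (μ (b p)) p) := by
  have hp := (H.block _ p).1 rfl
  obtain ⟨k, hk⟩ : ∃ k : ℕ, centreDist n (A.pos (μ (b p)) p) + 1 + k = d (b p) :=
    Int.le.dest hp
  induction k generalizing p with
  | zero => have := centreDist_lt (A.pos m p); push_cast at hk; omega
  | succ k ih =>
    have h2 := centreDist_nonneg n (A.pos (μ (b p)) p)
    push_cast at hk
    obtain ⟨q, hq⟩ := exists_centreDist_eq A (μ (b p))
      (centreDist n (A.pos (μ (b p)) p) + 1) (by omega) (by have := hdn (b p); omega)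
    have hb : b q = b p := (H.block _ _).2 (by omega)
    have h3 := ih q (by rw [hb]; omega) (by rw [hb]; omega)
    have h4 := (H.order_iff hb.symm (μ (b p)) m).1 (by omega)
    rw [hb] at h3
    omega

/-- `wv` combines three bounds: the wait after the last crossing, the wait before the next one, and
the ceiling `le_height`. -/
theorem le_wv (hdn : ∀ i, d i ≤ n) (p) (m : ℤ) : centreDist n (A.pos m p) ≤
    wv n (d (b p)) (d (b p) - 1 - centreDist n (A.pos (μ (b p)) p))
      ((m - μ (b p) - 1) % (2 * n)) := by
  have hn : (0 : ℤ) < n := by have := (A.pos m p).2; omega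
  have per : ∀ m k : ℤ, centreDist n (A.pos (m + 2 * n * k) p) = centreDist n (A.pos m p) := by
    intro m k
    induction k with
    | zero => simp
    | succ k ih => rw [← ih, ← H.periodic (m + 2 * n * k), mul_add, mul_one, add_assoc]
    | pred k ih =>
      rw [← ih, ← H.periodic (m + 2 * n * (-k - 1)), mul_sub, mul_one, add_assoc, sub_add_cancel]
  obtain ⟨q, r, r0, r1, hz⟩ := exists_qr hn (m - μ (b p) - 1)
  rw [(divmod r0 r1 hz).2]
  have h1 := H.forward hdn p r.toNat
  have h2 := H.backward hdn p (2 * n - 1 - r).toNat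
  have h3 := H.le_height hdn p m
  rw [Int.toNat_of_nonneg r0, ← per _ q, show μ (b p) + 1 + r + 2 * n * q = m by linarith] at h1
  rw [Int.toNat_of_nonneg (by omega), ← per _ (q + 1),
    show μ (b p) - (2 * n - 1 - r) + 2 * n * (q + 1) = m by linarith] at h2
  unfold wv
  omega

/-- The positions are given by the explicit formula. -/
theorem pos_eq [NeZero t] (hn : n = ∑ i, d i) (hd : ∀ i, 0 < d i) (ht : 2 ≤ t) :
    ∃ e : ((Σ i : Fin t, Fin (d i)) × Bool) ≃ Fin (2 * n), ∀ m x,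
      ((A.pos m (e x) : ℕ) : ℤ) =
        ps n (d x.1.1) (x.1.2 : ℕ) (blockTime d x.1.1) x.2 m := by
  have hdn : ∀ i, d i ≤ n := fun i => by
    rw [hn]; exact Finset.single_le_sum (f := d) (fun _ _ => Nat.zero_le _) (Finset.mem_univ i)
  have hdn' : ∀ i, (d i : ℤ) ≤ n := fun i => by exact_mod_cast hdn i
  have hμ := H.time_eq hn hd ht
  have hk : ∀ p, 0 ≤ (d (b p) - 1 - centreDist n (A.pos (μ (b p)) p)) ∧
      (d (b p) - 1 - centreDist n (A.pos (μ (b p)) p)) < d (b p) := fun p => by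
    have := (H.block _ p).1 rfl
    have := centreDist_nonneg n (A.pos (μ (b p)) p)
    omega
  let k : ∀ p, Fin (d (b p)) := fun p =>
    ⟨(d (b p) - 1 - centreDist n (A.pos (μ (b p)) p)).toNat, by have := hk p; omega⟩
  have kv : ∀ p, ((k p : ℕ) : ℤ) = d (b p) - 1 - centreDist n (A.pos (μ (b p)) p) :=
    fun p => Int.toNat_of_nonneg (hk p).1
  -- The sign of a label records the half in which the point lies just after its crossing switch, in
  -- accordance with `ps`.
  let s : Fin (2 * n) → Bool := fun p => decide (n ≤ (A.pos (μ (b p) + 1) p : ℕ))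
  let l : Fin (2 * n) → (Σ i : Fin t, Fin (d i)) × Bool := fun p => (⟨b p, k p⟩, s p)
  let f : ℤ → (Σ i : Fin t, Fin (d i)) × Bool → ℤ := fun m x =>
    ps n (d x.1.1) (x.1.2 : ℕ) (μ x.1.1) x.2 m
  have fb : ∀ m x, 0 ≤ f m x ∧ f m x < 2 * n := fun m x =>
    ps_bounds (hdn' _) (by omega) (by have := x.1.2.2; omega)
  have finj : ∀ m, Function.Injective (f m) := by
    intro m
    have lt : ∀ x y : (Σ i : Fin t, Fin (d i)) × Bool, x.1.1 < y.1.1 → f m x ≠ f m y := by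
      rintro ⟨⟨i, k⟩, s⟩ ⟨⟨j, l⟩, s'⟩ hij
      obtain ⟨S, R, hS, hR, e1, e2⟩ := blockTime_lt d hij
      rw [← hn] at e1
      simp only at e1 e2 hij
      have F := (flip_diff (δ := μ i) (s := s) (s' := s') (k := (k : ℕ)) (l := (l : ℕ))
        e1 hS hR (by omega) (by have := k.2; omega) (by omega) (by have := l.2; omega) m).1
      rwa [hμ i, ← e2, ← hμ i, ← hμ j] at F
    intro x y hxy
    rcases lt_trichotomy x.1.1 y.1.1 with h | h | h
    · exact absurd hxy (lt x y h)
    · obtain ⟨⟨i, k⟩, s⟩ := x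
      obtain ⟨⟨j, l⟩, s'⟩ := y
      simp only at h
      subst h
      by_contra hne
      refine (flip_same (n := n) (A := d i) (δ := μ i) (s := s) (s' := s') (k := (k : ℕ))
        (k' := (l : ℕ)) (hdn' i) (by omega) (by have := k.2; omega) (by omega)
        (by have := l.2; omega) ?_ m).1 hxy
      rintro ⟨h1, h2⟩
      apply hne
      have : k = l := Fin.ext (by exact_mod_cast h1)
      rw [this, h2]
    · exact absurd hxy.symm (lt y x h)
  have linj : Function.Injective l := by
    intro p q hpq
    have h1 : b p = b q := congrArg (fun x => x.1.1) hpq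
    have h2 : ((k p : ℕ) : ℤ) = (k q : ℕ) := congrArg (fun x => ((x.1.2 : ℕ) : ℤ)) hpq
    have h3 : s p = s q := congrArg (fun x => x.2) hpq
    rw [kv, kv, h1] at h2
    have hp := H.cross p
    have hq := H.cross q
    simp only [s, decide_eq_decide] at h3
    rw [h1] at h3 hp
    have h4 : centreDist n (A.pos (μ (b q) + 1) p) = centreDist n (A.pos (μ (b q) + 1) q) := by
      omega
    apply (A.pos (μ (b q) + 1)).injective
    apply Fin.ext
    unfold centreDist at h4
    split_ifs at h4 <;> omega
  have lbij : Function.Bijective l := by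
    rw [Fintype.bijective_iff_injective_and_card]
    exact ⟨linj, by simp [hn, mul_comm]⟩
  have dist : ∀ m p, centreDist n (A.pos m p) =
      wv n (d (b p)) (k p : ℕ) ((m - μ (b p) - 1) % (2 * n)) := by
    intro m
    have hle : ∀ p ∈ Finset.univ, centreDist n (A.pos m p) ≤
        wv n (d (b p)) (k p : ℕ) ((m - μ (b p) - 1) % (2 * n)) := by
      intro p _
      rw [kv]
      exact H.le_wv hdn p m
    let F : Fin (2 * n) → Fin (2 * n) := fun p => ⟨(f m (l p)).toNat, by
      have := fb m (l p); omega⟩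
    have Fv : ∀ p, ((F p : ℕ) : ℤ) = f m (l p) := fun p => Int.toNat_of_nonneg (fb m (l p)).1
    have Finj : Function.Injective F := by
      intro p q hpq
      apply linj
      apply finj m
      rw [← Fv, ← Fv, hpq]
    have Fd : ∀ p, centreDist n (F p) =
        wv n (d (b p)) (k p : ℕ) ((m - μ (b p) - 1) % (2 * n)) := by
      intro p
      have h1 := Fv p
      have h2 := (wv_bounds (n := n) (r := (m - μ (b p) - 1) % (2 * n)) (hdn' (b p))
        (Int.natCast_nonneg (k p)) (by exact_mod_cast (k p).2)).1
      have h3 : f m (l p) = _ := ps.eq_1 _ _ _ _ _ _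
      simp only [l] at h3
      rw [h3] at h1
      unfold centreDist
      split_ifs at h1 ⊢ <;> omega
    -- The actual positions and those of the formula are both bijections onto all positions, so the
    -- distances have equal sums. Termwise inequalities with equal sums are equalities.
    have hsum : ∑ p, centreDist n (A.pos m p) =
        ∑ p, wv n (d (b p)) (k p : ℕ) ((m - μ (b p) - 1) % (2 * n)) := by
      rw [Equiv.sum_comp (A.pos m) (fun x => centreDist n x),
        ← (Finite.injective_iff_bijective.1 Finj).sum_comp (fun x => centreDist n x)]
      exact Finset.sum_congr rfl fun p _ => Fd p
    exact fun p => (Finset.sum_eq_sum_iff_of_le hle).1 hsum p (Finset.mem_univ p)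
  -- Only the side remains to be determined. The two descriptions agree just after the crossing
  -- switch and change sides in the same moves.
  have hside : ∀ p m, (n ≤ (A.pos m p : ℕ) ↔ (n : ℤ) ≤ f m (l p)) := by
    intro p
    have hs : ∀ m, ((n ≤ (A.pos m p : ℕ) ↔ (n : ℤ) ≤ f m (l p)) ↔
        (n ≤ (A.pos (m + 1) p : ℕ) ↔ (n : ℤ) ≤ f (m + 1) (l p))) := by
      intro m
      have h1 := H.side p m
      by_cases hm : (m - μ (b p)) % (2 * n) = 0
      · have : f (m + 1) (l p) = 2 * n - 1 - f m (l p) :=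
          (ps_cross (hdn' _) (by omega) (by exact_mod_cast (k p).2) hm).1
        have := h1.2 hm
        omega
      · have : (n : ℤ) ≤ f m (l p) ↔ n ≤ f (m + 1) (l p) :=
          (ps_step (hdn' _) (by omega) (by exact_mod_cast (k p).2) hm).1
        have := mt h1.1 hm
        tauto
    have h0 : (n ≤ (A.pos (μ (b p) + 1) p : ℕ) ↔ (n : ℤ) ≤ f (μ (b p) + 1) (l p)) := by
      have hk' := (k p).2
      have hdn'' := hdn' (b p)
      have h3 : f (μ (b p) + 1) (l p) = _ :=
        ps_eq (q := 0) (r := 0) le_rfl (by omega) (by ring)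
      have h2 := (wv_bounds (n := n) (r := 0) (hdn' (b p))
        (Int.natCast_nonneg (k p)) (by exact_mod_cast (k p).2)).1
      rw [h3]
      simp only [l, s, decide_eq_true_eq]
      split_ifs with h <;> simp at h <;> omega
    have hall : ∀ j : ℤ, (n ≤ (A.pos (μ (b p) + 1 + j) p : ℕ) ↔
        (n : ℤ) ≤ f (μ (b p) + 1 + j) (l p)) := by
      intro j
      induction j with
      | zero => simpa using h0
      | succ j ih => rw [← add_assoc]; exact (hs _).1 ih
      | pred j ih => rw [hs, add_assoc, sub_add_cancel]; exact ih
    intro m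
    have := hall (m - (μ (b p) + 1))
    rwa [add_sub_cancel] at this
  refine ⟨(Equiv.ofBijective l lbij).symm, fun m x => ?_⟩
  obtain ⟨p, rfl⟩ := lbij.2 x
  have h1 : (Equiv.ofBijective l lbij).symm (l p) = p :=
    (Equiv.ofBijective l lbij).symm_apply_apply p
  rw [h1, ← hμ]
  have h2 := hside p m
  have h3 : f m (l p) = _ := ps.eq_1 _ _ _ _ _ _
  have h4 := dist m p
  have h5 : f m (l p) = ps n (d (l p).1.1) ((l p).1.2 : ℕ) (μ (l p).1.1) (l p).2 m := rfl
  rw [← h5]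
  have h6 := (wv_bounds (n := n) (r := (m - μ (b p) - 1) % (2 * n)) (hdn' (b p))
    (Int.natCast_nonneg (k p)) (by exact_mod_cast (k p).2)).1
  simp only [l] at h3 h2 ⊢
  unfold centreDist at h4
  split_ifs at h3 h4 <;> omega

end CentralDynamics

/-- The allowable sequence with the properties `IsDC d` is unique: its positions are given by an
explicit formula. -/
theorem IsDC.exists_label {n t : ℕ} [NeZero t] {A : AllowableSequence (2 * n)} {d : Fin t → ℕ}
    (hA : A.IsDC d) (hn : n = ∑ i, d i) (hd : ∀ i, 0 < d i) (ht : 2 ≤ t) :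
    ∃ e : ((Σ i : Fin t, Fin (d i)) × Bool) ≃ Fin (2 * n), ∀ m x,
      ((A.pos m (e x) : ℕ) : ℤ) =
        DCExistence.ps n (d x.1.1) (x.1.2 : ℕ) (blockTime d x.1.1) x.2 m := by
  obtain ⟨μ, b, H⟩ := exists_centralDynamics hA
  exact H.pos_eq hn hd ht

end AllowableSequence

/-! ### Three consecutive blocks of size two, counted cyclically. -/

namespace DCExistence

/-- A halfperiod exchanges a point with its conjugate, so an odd shift amounts to a change of sign.
This lets consecutive blocks straddle the end of a halfperiod. -/
theorem ps_shift (n A δ z : ℤ) (hn : 0 < n) :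
    ∃ f : Bool → Bool, ∀ k s m, ps n A k (δ + 2 * n * z) s m = ps n A k δ (f s) m := by
  refine ⟨fun s => if z % 2 = 0 then s else !s, fun k s m => ?_⟩
  obtain ⟨q, r, h0, h1, hz⟩ := exists_qr hn (m - δ - 1)
  rw [ps_eq h0 h1 hz, ps_eq (q := q - z) h0 h1 (by linarith)]
  by_cases h2 : z % 2 = 0
  · have : (q - z) % 2 = q % 2 := by omega
    simp [this, h2]
  · have : (q - z) % 2 = 0 ↔ ¬ q % 2 = 0 := by omega
    cases s <;> simp [this, h2]

end DCExistence

namespace AllowableSequence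

open DCExistence Real

/-- The correction `z` is 1 for the passage from the last block to the first and 0 otherwise. -/
theorem blockTime_add_one {t : ℕ} [NeZero t] (d : Fin t → ℕ) (i : Fin t) :
    ∃ z : ℤ, blockTime d (i + 1) + 2 * (∑ i, d i : ℕ) * z =
      blockTime d i + (d i + d (i + 1)) := by
  have h1 := prefixSum_succ d i
  have hv : ((i + 1 : Fin t) : ℕ) = (i + 1) % t := by
    rw [Fin.val_add]; simp
  by_cases hi : (i : ℕ) + 1 < t
  · rw [Nat.mod_eq_of_lt hi] at hv
    refine ⟨0, ?_⟩
    unfold blockTime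
    rw [hv]
    push_cast [h1]
    ring
  · have hi' : (i : ℕ) + 1 = t := by have := i.2; omega
    rw [hi', Nat.mod_self] at hv
    have h0 : i + 1 = 0 := Fin.ext (by rw [hv]; rfl)
    rw [hi', prefixSum_self] at h1
    refine ⟨1, ?_⟩
    unfold blockTime
    rw [h0, h1]
    simp only [Fin.val_zero, prefixSum_zero]
    push_cast
    ring

/-- The positions of the points of three consecutive blocks of size two; the blocks are counted
from an arbitrary one and may belong to different halfperiods. -/
theorem IsDC.exists_three_blocks {n t : ℕ} [NeZero t] {A : AllowableSequence (2 * n)}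
    {d : Fin t → ℕ} (hA : A.IsDC d) (hn : n = ∑ i, d i) (hd : ∀ i, 0 < d i) (ht : 3 ≤ t)
    (i : Fin t) (h0 : d i = 2) (h1 : d (i + 1) = 2) (h2 : d (i + 2) = 2) :
    ∃ (δ : ℤ) (g : Fin 3 → Fin 2 → Bool → Fin (2 * n)), ∀ m j k s,
      ((A.pos m (g j k s) : ℕ) : ℤ) = ps n 2 (k : ℕ) (δ + 4 * (j : ℕ)) s m := by
  obtain ⟨e, he⟩ := hA.exists_label hn hd (by omega)
  have hn0 : (0 : ℤ) < n := by
    have := Finset.single_le_sum (f := d) (fun _ _ => Nat.zero_le _) (Finset.mem_univ i)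
    omega
  have key : ∀ j : Fin t, d j = 2 → ∀ δ z : ℤ, blockTime d j + 2 * n * z = δ →
      ∃ g : Fin 2 → Bool → Fin (2 * n), ∀ m k s,
        ((A.pos m (g k s) : ℕ) : ℤ) = ps n 2 (k : ℕ) δ s m := by
    rintro j hj δ z rfl
    obtain ⟨f, hf⟩ := ps_shift n 2 (blockTime d j) z hn0
    refine ⟨fun k s => e (⟨j, k.cast hj.symm⟩, f s), fun m k s => ?_⟩
    rw [he, hf]
    simp [hj]
  obtain ⟨z, hz⟩ := blockTime_add_one d i
  obtain ⟨z', hz'⟩ := blockTime_add_one d (i + 1)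
  have hi2 : i + 1 + 1 = i + 2 := by
    apply Fin.ext
    simp only [Fin.val_add, Fin.val_one']
    simp
  rw [hi2] at hz'
  rw [← hn, h0, h1] at hz
  rw [← hn, h1, h2] at hz'
  obtain ⟨g0, hg0⟩ := key i h0 (blockTime d i) 0 (by ring)
  obtain ⟨g1, hg1⟩ := key (i + 1) h1 (blockTime d i + 4) z (by rw [hz]; norm_num)
  obtain ⟨g2, hg2⟩ := key (i + 2) h2 (blockTime d i + 8) (z' + z) (by
    rw [mul_add, ← add_assoc, hz']
    push_cast at hz ⊢
    linarith)
  refine ⟨blockTime d i, ![g0, g1, g2], fun m j k s => ?_⟩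
  fin_cases j
  · simpa using hg0 m k s
  · simpa using hg1 m k s
  · simpa using hg2 m k s

/-! ### Realizations -/

theorem inner_cos_sin (v : EuclideanSpace ℝ (Fin 2)) (φ : ℝ) :
    inner ℝ v !₂[cos φ, sin φ] = v 0 * cos φ + v 1 * sin φ := by
  simp [PiLp.inner_apply, Fin.sum_univ_two]
  ring

/-- The labelled points `x` have the circular sequence `A` with critical angles `c`. -/
structure Realizes {N : ℕ} (A : AllowableSequence N) (x : Fin N → EuclideanSpace ℝ (Fin 2))
    (c : ℤ → ℝ) : Prop where
  mono : StrictMono c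
  add_h : ∀ i, c (i + A.h) = c i + π
  order : ∀ i, ∀ φ ∈ Set.Ioo (c i) (c (i + 1)), ∀ p q, A.pos i p < A.pos i q ↔
    x p 0 * cos φ + x p 1 * sin φ < x q 0 * cos φ + x q 1 * sin φ

theorem isRealization_iff {N : ℕ} (A : AllowableSequence N) (P : Set (EuclideanSpace ℝ (Fin 2))) :
    A.IsRealization P ↔ ∃ x, Set.range x = P ∧ ∃ c, A.Realizes x c := by
  unfold IsRealization
  simp only [inner_cos_sin]
  exact ⟨fun ⟨x, hx, c, h1, h2, h3⟩ => ⟨x, hx, c, h1, h2, h3⟩,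
    fun ⟨x, hx, c, h1, h2, h3⟩ => ⟨x, hx, c, h1, h2, h3⟩⟩

theorem nonneg_of_pos_on_Ioo {g : ℝ → ℝ} (hg : Continuous g) {a b : ℝ} (hab : a < b)
    (h : ∀ φ ∈ Set.Ioo a b, 0 < g φ) : 0 ≤ g a ∧ 0 ≤ g b := by
  have : Set.Icc a b ⊆ {φ | 0 ≤ g φ} := by
    rw [← closure_Ioo hab.ne]
    exact closure_minimal (fun φ hφ => (h φ hφ).le) (isClosed_le continuous_const hg)
  exact ⟨this ⟨le_rfl, hab.le⟩, this ⟨hab.le, le_rfl⟩⟩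

namespace Realizes

variable {N : ℕ} {A : AllowableSequence N} {x : Fin N → EuclideanSpace ℝ (Fin 2)} {c : ℤ → ℝ}

/-- Points whose order changes in a move have the same projection at the critical angle. -/
theorem proj_eq (R : A.Realizes x c) {m : ℤ} {p q : Fin N} (hpq : p ≠ q) (h : A.Flips m p q) :
    x p 0 * cos (c (m + 1)) + x p 1 * sin (c (m + 1)) =
      x q 0 * cos (c (m + 1)) + x q 1 * sin (c (m + 1)) := by
  have key : ∀ p q : Fin N, A.pos m p < A.pos m q → A.pos (m + 1) q < A.pos (m + 1) p →
      x p 0 * cos (c (m + 1)) + x p 1 * sin (c (m + 1)) =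
      x q 0 * cos (c (m + 1)) + x q 1 * sin (c (m + 1)) := by
    intro p q h1 h2
    -- By continuity the strict orders on the two sides of the critical angle give opposite weak
    -- inequalities at it.
    have a1 := (nonneg_of_pos_on_Ioo
      (g := fun φ => x q 0 * cos φ + x q 1 * sin φ - (x p 0 * cos φ + x p 1 * sin φ))
      (by fun_prop) (R.mono (show m < m + 1 by omega))
      fun φ hφ => sub_pos.2 ((R.order m φ hφ p q).1 h1)).2
    have a2 := (nonneg_of_pos_on_Ioo
      (g := fun φ => x p 0 * cos φ + x p 1 * sin φ - (x q 0 * cos φ + x q 1 * sin φ))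
      (by fun_prop) (R.mono (show m + 1 < m + 1 + 1 by omega))
      fun φ hφ => sub_pos.2 ((R.order (m + 1) φ hφ q p).1 h2)).1
    simp only at a1 a2
    linarith
  have n1 : A.pos m p ≠ A.pos m q := fun h => hpq ((A.pos m).injective h)
  have n2 : A.pos (m + 1) p ≠ A.pos (m + 1) q := fun h => hpq ((A.pos (m + 1)).injective h)
  unfold Flips at h
  rcases lt_or_gt_of_ne n1 with h1 | h1
  · exact key p q h1 (lt_of_le_of_ne (not_lt.1 (h.1 h1)) n2.symm)
  · refine (key q p h1 ?_).symm
    by_contra h2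
    exact absurd (h.2 h2) (not_lt.2 h1.le)

/-- A vector which is orthogonal to two critical directions vanishes. -/
theorem eq_zero (R : A.Realizes x c) {i j : ℤ} (hij : i < j) (hji : j < i + A.h) {v w : ℝ}
    (hi : v * cos (c i) + w * sin (c i) = 0) (hj : v * cos (c j) + w * sin (c j) = 0) :
    v = 0 ∧ w = 0 := by
  have h1 := R.mono hij
  have h2 := R.mono hji
  rw [R.add_h] at h2
  have h3 : 0 < sin (c j - c i) := sin_pos_of_pos_of_lt_pi (by linarith) (by linarith)
  rw [sin_sub] at h3
  constructor
  · have : v * (sin (c j) * cos (c i) - cos (c j) * sin (c i)) = 0 := by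
      linear_combination sin (c j) * hi - sin (c i) * hj
    exact (mul_eq_zero.1 this).resolve_right h3.ne'
  · have : w * (sin (c j) * cos (c i) - cos (c j) * sin (c i)) = 0 := by
      linear_combination cos (c i) * hj - cos (c j) * hi
    exact (mul_eq_zero.1 this).resolve_right h3.ne'

end Realizes

/-- Eliminates the unknown angle from two switches of the same move. -/
theorem cross_eq_zero {v w v' w' φ : ℝ} (h : v * cos φ + w * sin φ = 0)
    (h' : v' * cos φ + w' * sin φ = 0) : v * w' - w * v' = 0 := by
  have := sin_sq_add_cos_sq φ
  linear_combination (-(v * w' - w * v')) * this + (w' * cos φ - v' * sin φ) * h +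
    (v * sin φ - w * cos φ) * h'

/-- The incidences of three consecutive blocks of size two determine them up to an affine map. -/
theorem golden_of_cross {a a' b b' c c' α β γ : ℝ} (hab : a * b' - a' * b ≠ 0)
    (hbc : b * c' - b' * c ≠ 0) (hac : a * c' - a' * c ≠ 0)
    (e1 : (a + b) * (α * a' + β * b') - (a' + b') * (α * a + β * b) = 0)
    (e2 : (b + c) * (β * b' + γ * c') - (b' + c') * (β * b + γ * c) = 0)
    (e3 : (a + c) * b' - (a' + c') * b = 0)
    (e4 : (a + γ * c) * (α * a' + b') - (a' + γ * c') * (α * a + b) = 0)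
    (e5 : (a - β * b) * (α * a' - c') - (a' - β * b') * (α * a - c) = 0) :
    β = α ∧ γ = α ∧ α ^ 2 + α = 1 ∧ b = a + c ∧ b' = a' + c' := by
  have h1 : β = α := by
    have : (β - α) * (a * b' - a' * b) = 0 := by linear_combination e1
    exact sub_eq_zero.1 ((mul_eq_zero.1 this).resolve_right hab)
  have h2 : γ = α := by
    have : (γ - β) * (b * c' - b' * c) = 0 := by linear_combination e2
    exact (sub_eq_zero.1 ((mul_eq_zero.1 this).resolve_right hbc)).trans h1
  subst h1 h2
  -- By `e3`, b is a multiple of a + c; the factor is the quotient of the areas a × b and a × c.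
  obtain ⟨ν, hν⟩ : ∃ ν, ν * (a * c' - a' * c) = a * b' - a' * b := ⟨_, div_mul_cancel₀ _ hac⟩
  have hb : b = ν * (a + c) := by
    apply mul_right_cancel₀ hac
    linear_combination (-(a + c)) * hν - a * e3
  have hb' : b' = ν * (a' + c') := by
    apply mul_right_cancel₀ hac
    linear_combination (-(a' + c')) * hν - a' * e3
  have hν0 : ν ≠ 0 := by
    rintro rfl
    apply hab
    rw [hb, hb']
    ring
  rw [hb, hb'] at e4 e5
  have f4 : ν - γ * (γ + ν) = 0 := by
    apply (mul_eq_zero.1 (_ : _ * (a * c' - a' * c) = 0)).resolve_right hac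
    linear_combination e4
  have f5 : γ * ν + γ ^ 2 * ν - 1 = 0 := by
    apply (mul_eq_zero.1 (_ : _ * (a * c' - a' * c) = 0)).resolve_right hac
    linear_combination e5
  -- Eliminating ν from `f4` and `f5` leaves a quartic in γ, whose other factor has no real zero.
  have f6 : γ ^ 2 + γ = 1 := by
    have : (γ ^ 2 + 1) * (γ ^ 2 + γ - 1) = 0 := by
      linear_combination (-(γ + γ ^ 2)) * f4 + (1 - γ) * f5
    have h := (mul_eq_zero.1 this).resolve_left (by positivity)
    linarith
  have f7 : ν = 1 := by linear_combination f5 - ν * f6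
  refine ⟨rfl, rfl, f6, ?_, ?_⟩
  · rw [hb, f7, one_mul]
  · rw [hb', f7, one_mul]

end AllowableSequence

/-! ### Rigidity of the three blocks. -/

namespace AllowableSequence

open DCExistence Real

theorem flips_iff_cast {N : ℕ} (A : AllowableSequence N) (m : ℤ) (p q : Fin N) :
    A.Flips m p q ↔ (((A.pos m p : ℕ) : ℤ) < (A.pos m q : ℕ) ↔
      ¬ ((A.pos (m + 1) p : ℕ) : ℤ) < (A.pos (m + 1) q : ℕ)) := by
  unfold Flips
  simp only [Fin.lt_def, Nat.cast_lt]

namespace Realizes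

variable {n : ℕ} {A : AllowableSequence (2 * n)} {x : Fin (2 * n) → EuclideanSpace ℝ (Fin 2)}
  {c : ℤ → ℝ} {δ : ℤ} {g : Fin 3 → Fin 2 → Bool → Fin (2 * n)}

/-- The difference of a point and its conjugate is orthogonal to the direction of its block. -/
theorem block_proj (R : A.Realizes x c) (hn : 2 ≤ n)
    (hg : ∀ m j k s, ((A.pos m (g j k s) : ℕ) : ℤ) = ps n 2 (k : ℕ) (δ + 4 * (j : ℕ)) s m)
    (j : Fin 3) (k : Fin 2) :
    (x (g j k true) - x (g j k false)) 0 * cos (c (δ + 4 * (j : ℕ) + 1)) +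
      (x (g j k true) - x (g j k false)) 1 * sin (c (δ + 4 * (j : ℕ) + 1)) = 0 := by
  have F := fun m => flip_same (n := n) (A := 2) (k := (k : ℕ)) (k' := (k : ℕ))
    (δ := δ + 4 * (j : ℕ)) (s := true) (s' := false) (by omega) (by omega) (by omega) (by omega)
    (by omega) (by simp) m
  have hne : g j k true ≠ g j k false := fun h => (F 0).1 (by rw [← hg, ← hg, h])
  have h := R.proj_eq hne ((A.flips_iff_cast _ _ _).2 (by
    simp only [hg]
    exact (F (δ + 4 * (j : ℕ))).2.1 (by simp)))
  simp only [PiLp.sub_apply]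
  linarith

/-- The relations between the points of two different blocks. -/
theorem blocks_proj (R : A.Realizes x c) (hn : 6 ≤ n)
    (hg : ∀ m j k s, ((A.pos m (g j k s) : ℕ) : ℤ) = ps n 2 (k : ℕ) (δ + 4 * (j : ℕ)) s m)
    {i j : Fin 3} (hij : i < j) (k l : Fin 2) (s s' : Bool) (m : ℤ)
    (hm : m = if s = s' then δ + 4 * (i : ℕ) + (n + 2 * ((j : ℕ) - (i : ℕ)) + (l : ℕ) - (k : ℕ))
      else δ + 4 * (i : ℕ) + (2 * ((j : ℕ) - (i : ℕ)) + (k : ℕ) - (l : ℕ))) :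
    x (g i k s) 0 * cos (c (m + 1)) + x (g i k s) 1 * sin (c (m + 1)) =
      x (g j l s') 0 * cos (c (m + 1)) + x (g j l s') 1 * sin (c (m + 1)) := by
  -- `S` is the total size of the blocks strictly between the two, so that `2 + 2 * S + 2` is their
  -- time difference; `R` is the size of what remains.
  have F := fun m => flip_diff (n := n) (A := 2) (B := 2) (S := 2 * ((j : ℕ) - (i : ℕ)) - 2)
    (R := n - 2 - 2 * ((j : ℕ) - (i : ℕ)))
    (k := (k : ℕ)) (l := (l : ℕ)) (δ := δ + 4 * (i : ℕ)) (s := s) (s' := s') (by ring) (by omega)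
    (by omega) (by omega) (by omega) (by omega) (by omega) m
  rw [show δ + 4 * ((i : ℕ) : ℤ) + (2 + 2 * (2 * ((j : ℕ) - (i : ℕ)) - 2) + 2) =
    δ + 4 * (j : ℕ) by ring] at F
  have hne : g i k s ≠ g j l s' := fun h => (F 0).1 (by rw [← hg, ← hg, h])
  refine R.proj_eq hne ((A.flips_iff_cast _ _ _).2 ?_)
  simp only [hg]
  refine (F m).2.1 ?_
  rw [hm]
  apply Int.emod_eq_zero_of_dvd
  split_ifs <;> ring_nf <;> exact dvd_zero _

/-- The relations between the symmetrized vectors of two different blocks. -/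
theorem blocks_proj_opp (R : A.Realizes x c) (hn : 6 ≤ n)
    (hg : ∀ m j k s, ((A.pos m (g j k s) : ℕ) : ℤ) = ps n 2 (k : ℕ) (δ + 4 * (j : ℕ)) s m)
    {i j : Fin 3} (hij : i < j) (k l : Fin 2) (m : ℤ)
    (hm : m = δ + 4 * (i : ℕ) + (2 * ((j : ℕ) - (i : ℕ)) + (k : ℕ) - (l : ℕ))) :
    ((x (g i k true) - x (g i k false)) 0 + (x (g j l true) - x (g j l false)) 0) *
        cos (c (m + 1)) +
      ((x (g i k true) - x (g i k false)) 1 + (x (g j l true) - x (g j l false)) 1) *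
        sin (c (m + 1)) = 0 := by
  have h1 := R.blocks_proj hn hg hij k l true false m (by simpa using hm)
  have h2 := R.blocks_proj hn hg hij k l false true m (by simpa using hm)
  simp only [PiLp.sub_apply]
  linarith

/-- For equal signs the two equations are subtracted in such a way that the difference of the
vectors appears in place of their sum. -/
theorem blocks_proj_same (R : A.Realizes x c) (hn : 6 ≤ n)
    (hg : ∀ m j k s, ((A.pos m (g j k s) : ℕ) : ℤ) = ps n 2 (k : ℕ) (δ + 4 * (j : ℕ)) s m)
    {i j : Fin 3} (hij : i < j) (k l : Fin 2) (m : ℤ)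
    (hm : m = δ + 4 * (i : ℕ) + (n + 2 * ((j : ℕ) - (i : ℕ)) + (l : ℕ) - (k : ℕ))) :
    ((x (g i k true) - x (g i k false)) 0 - (x (g j l true) - x (g j l false)) 0) *
        cos (c (m + 1)) +
      ((x (g i k true) - x (g i k false)) 1 - (x (g j l true) - x (g j l false)) 1) *
        sin (c (m + 1)) = 0 := by
  have h1 := R.blocks_proj hn hg hij k l true true m (by simpa using hm)
  have h2 := R.blocks_proj hn hg hij k l false false m (by simpa using hm)
  simp only [PiLp.sub_apply]
  linarith

/-- In a realization the midpoints of conjugate points from different blocks agree. -/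
theorem midpoint_eq (R : A.Realizes x c) (hn : 6 ≤ n) (hh : A.h = 2 * n)
    (hg : ∀ m j k s, ((A.pos m (g j k s) : ℕ) : ℤ) = ps n 2 (k : ℕ) (δ + 4 * (j : ℕ)) s m)
    {i j : Fin 3} (hij : i < j) (k l : Fin 2) :
    x (g i k true) + x (g i k false) = x (g j l true) + x (g j l false) := by
  have h1 := R.blocks_proj hn hg hij k l true true _ rfl
  have h2 := R.blocks_proj hn hg hij k l false false _ rfl
  have h3 := R.blocks_proj hn hg hij k l true false _ rfl
  have h4 := R.blocks_proj hn hg hij k l false true _ rfl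
  simp only [if_true, reduceCtorEq, if_false] at h1 h2 h3 h4
  -- Twice the difference of the midpoints is orthogonal to two critical directions: the one in
  -- which points of equal signs meet and the one in which points of opposite signs meet.
  have := R.eq_zero (v := x (g i k true) 0 + x (g i k false) 0 -
      (x (g j l true) 0 + x (g j l false) 0))
    (w := x (g i k true) 1 + x (g i k false) 1 - (x (g j l true) 1 + x (g j l false) 1))
    (i := δ + 4 * (i : ℕ) + (2 * ((j : ℕ) - (i : ℕ)) + (k : ℕ) - (l : ℕ)) + 1)
    (j := δ + 4 * (i : ℕ) + (n + 2 * ((j : ℕ) - (i : ℕ)) + (l : ℕ) - (k : ℕ)) + 1)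
    (by omega) (by rw [hh]; push_cast; omega) (by linarith) (by linarith)
  ext a
  fin_cases a
  · simpa using sub_eq_zero.1 this.1
  · simpa using sub_eq_zero.1 this.2

/-- A realization of a sequence with three consecutive blocks of size two: there are no other
blocks, and the symmetrized points form two affinely regular hexagons, the ratio of which is the
golden ratio. -/
theorem rigid (R : A.Realizes x c) (hn : 6 ≤ n) (hh : A.h = 2 * n)
    (hg : ∀ m j k s, ((A.pos m (g j k s) : ℕ) : ℤ) = ps n 2 (k : ℕ) (δ + 4 * (j : ℕ)) s m)
    {y : Fin 3 → Fin 2 → EuclideanSpace ℝ (Fin 2)}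
    (hy : ∀ j k, y j k = x (g j k true) - x (g j k false)) :
    n = 6 ∧ y 0 0 0 * y 2 0 1 - y 0 0 1 * y 2 0 0 ≠ 0 ∧ y 1 0 = y 0 0 + y 2 0 ∧
      ∃ α : ℝ, 0 < α ∧ α ^ 2 + α = 1 ∧ ∀ j, y j 1 = α • y j 0 := by
  have hb := fun j k => R.block_proj (by omega) hg j k
  have ho := fun {i j : Fin 3} (hij : i < j) k l => R.blocks_proj_opp hn hg hij k l _ rfl
  have hs := fun {i j : Fin 3} (hij : i < j) k l => R.blocks_proj_same hn hg hij k l _ rfl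
  simp only [← hy] at hb ho hs
  -- the vectors point outward at the beginning of the halfperiod
  have hpos : ∀ j, ∃ φ, ∀ k, 0 < y j k 0 * cos φ + y j k 1 * sin φ := by
    intro j
    obtain ⟨φ, hφ⟩ := exists_between (R.mono (show δ + 4 * (j : ℕ) + 1 < δ + 4 * (j : ℕ) + 1 + 1
      by omega))
    refine ⟨φ, fun k => ?_⟩
    have h1 := (R.order _ φ hφ (g j k false) (g j k true)).1 (by
      rw [Fin.lt_def]
      have h1 := hg (δ + 4 * (j : ℕ) + 1) j k false
      have h2 := hg (δ + 4 * (j : ℕ) + 1) j k true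
      rw [ps_eq (q := 0) (r := 0) le_rfl (by omega) (by ring)] at h1 h2
      have := (wv_bounds (n := n) (A := 2) (k := (k : ℕ)) (r := 0) (by omega) (by omega)
        (by omega)).1
      simp at h1 h2
      omega)
    rw [hy]
    simp only [PiLp.sub_apply]
    linarith
  have hne : ∀ j k, ¬ (y j k 0 = 0 ∧ y j k 1 = 0) := by
    rintro j k ⟨h0, h1⟩
    obtain ⟨φ, hφ⟩ := hpos j
    have := hφ k
    rw [h0, h1] at this
    simp at this
  -- If the outer vectors of two blocks were parallel, the second would be orthogonal to the
  -- crossing directions of both blocks and would vanish.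
  have hcross : ∀ i j, i < j → y i 0 0 * y j 0 1 - y i 0 1 * y j 0 0 ≠ 0 := by
    intro i j hij h
    have hi := hb i 0
    have hj := hb j 0
    apply hne j 0
    refine R.eq_zero (i := δ + 4 * (i : ℕ) + 1) (j := δ + 4 * (j : ℕ) + 1) (by omega)
      (by rw [hh]; push_cast; omega) ?_ hj
    have e0 : y i 0 0 * (y j 0 0 * cos (c (δ + 4 * (i : ℕ) + 1)) +
        y j 0 1 * sin (c (δ + 4 * (i : ℕ) + 1))) = 0 := by
      linear_combination y j 0 0 * hi + sin (c (δ + 4 * (i : ℕ) + 1)) * h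
    have e1 : y i 0 1 * (y j 0 0 * cos (c (δ + 4 * (i : ℕ) + 1)) +
        y j 0 1 * sin (c (δ + 4 * (i : ℕ) + 1))) = 0 := by
      linear_combination y j 0 1 * hi - cos (c (δ + 4 * (i : ℕ) + 1)) * h
    by_contra hc
    exact hne i 0 ⟨(mul_eq_zero.1 e0).resolve_right hc, (mul_eq_zero.1 e1).resolve_right hc⟩
  have hpar : ∀ j, ∃ α : ℝ, y j 1 0 = α * y j 0 0 ∧ y j 1 1 = α * y j 0 1 := by
    intro j
    have h := cross_eq_zero (hb j 0) (hb j 1)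
    by_cases h0 : y j 0 0 = 0
    · have h1 : y j 0 1 ≠ 0 := fun h1 => hne j 0 ⟨h0, h1⟩
      rw [h0] at h ⊢
      refine ⟨y j 1 1 / y j 0 1, ?_, by field_simp⟩
      have : y j 0 1 * y j 1 0 = 0 := by linarith
      simpa using (mul_eq_zero.1 this).resolve_left h1
    · refine ⟨y j 1 0 / y j 0 0, by field_simp, ?_⟩
      field_simp
      linarith
  choose α hα0 hα1 using hpar
  have at3 : ∀ {v w m m'}, v * cos (c m) + w * sin (c m) = 0 → m = m' →
      v * cos (c m') + w * sin (c m') = 0 := fun h e => e ▸ h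
  have l01 : (0 : Fin 3) < 1 := by decide
  have l12 : (1 : Fin 3) < 2 := by decide
  have l02 : (0 : Fin 3) < 2 := by decide
  -- Coincidences of switches: the moves from the permutations δ+2, δ+6, δ+4, δ+3 and δ+n+3 each
  -- contain two of the relations. In `e3` one of them is the crossing switch of the middle block.
  have e1 := cross_eq_zero (ho l01 0 0) (at3 (ho l01 1 1) (by simp))
  have e2 := cross_eq_zero (ho l12 0 0) (at3 (ho l12 1 1) (by simp))
  have e3 := cross_eq_zero (ho l02 0 0) (at3 (hb 1 0) (by simp))
  have e4 := cross_eq_zero (ho l02 0 1) (at3 (ho l01 1 0) (by simp))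
  have e5 := cross_eq_zero (hs l01 0 1) (at3 (hs l02 1 0) (by simp; ring))
  rw [hα0, hα1, hα0, hα1] at e1 e2
  rw [hα0, hα1, hα0, hα1] at e4 e5
  obtain ⟨g1, g2, g3, g4, g5⟩ := golden_of_cross (hcross 0 1 l01) (hcross 1 2 l12) (hcross 0 2 l02)
    e1 e2 e3 e4 e5
  have hy1 : y 1 0 = y 0 0 + y 2 0 := by
    ext a
    fin_cases a
    · exact g4
    · exact g5
  refine ⟨?_, hcross 0 2 l02, hy1, α 0, ?_, g3, ?_⟩
  -- By α² + α = 1 the vectors αb + c and αa - b are parallel. They are orthogonal to the critical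
  -- directions with indices δ+8 and δ+n+2, which are different and less than a halfperiod apart if
  -- n > 6; then αa - b vanishes, although a and c are independent.
  · by_contra h6
    have f1 := ho l12 1 0
    have f2 := hs l01 1 0
    rw [hα0, hα1, g1, g4, g5] at f1
    rw [hα0, hα1, g4, g5] at f2
    have hac := hcross 0 2 l02
    have := R.eq_zero (v := (α 0) * y 0 0 0 - (y 0 0 0 + y 2 0 0))
      (w := (α 0) * y 0 0 1 - (y 0 0 1 + y 2 0 1)) (i := δ + 7 + 1) (j := δ + n + 1 + 1) (by omega)
      (by rw [hh]; push_cast; omega) ?_ (at3 f2 (by simp; ring))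
    · apply hac
      linear_combination y 0 0 1 * this.1 - y 0 0 0 * this.2
    · have f3 := at3 f1 (m' := δ + 7 + 1) (by simp; ring)
      linear_combination (-α 0) * f3 + ((y 0 0 0 + y 2 0 0) * cos (c (δ + 7 + 1)) +
        (y 0 0 1 + y 2 0 1) * sin (c (δ + 7 + 1))) * g3
  -- Just after the crossing switch the inner and outer vectors of a block have positive
  -- projections; this selects the positive root α.
  · obtain ⟨φ, hφ⟩ := hpos 0
    have h0 := hφ 0
    have h1 := hφ 1
    rw [hα0, hα1] at h1
    have : 0 < α 0 * (y 0 0 0 * cos φ + y 0 0 1 * sin φ) := by linarith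
    exact pos_of_mul_pos_left this h0.le
  · intro j
    have : α j = α 0 := by
      fin_cases j
      · rfl
      · exact g1
      · exact g2
    rw [← this]
    ext a
    fin_cases a
    · exact hα0 j
    · exact hα1 j

end Realizes

end AllowableSequence

/-! ### Affine normal form, and the bound on the number of blocks. -/

namespace AllowableSequence

open DCExistence Real

/-- The labels of the points of three blocks of size two fill all positions of twelve points. -/
theorem surjective_of_three_blocks {n : ℕ} {A : AllowableSequence (2 * n)} (hn : n = 6) {δ : ℤ}
    {g : Fin 3 → Fin 2 → Bool → Fin (2 * n)}
    (hg : ∀ m j k s, ((A.pos m (g j k s) : ℕ) : ℤ) = ps n 2 (k : ℕ) (δ + 4 * (j : ℕ)) s m) :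
    Function.Bijective fun a : Fin 3 × Fin 2 × Bool => g a.1 a.2.1 a.2.2 := by
  subst hn
  rw [Fintype.bijective_iff_injective_and_card]
  refine ⟨fun a b hab => ?_, by simp⟩
  have h1 := hg δ a.1 a.2.1 a.2.2
  have h2 := hg δ b.1 b.2.1 b.2.2
  simp only at hab
  rw [hab, h2] at h1
  -- Only time differences enter `ps`, so δ may be taken to be 0 and injectivity becomes a finite
  -- check.
  have hps : ∀ a : Fin 3 × Fin 2 × Bool,
      ps (6 : ℕ) 2 (a.2.1 : ℕ) (δ + 4 * (a.1 : ℕ)) a.2.2 δ =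
        ps 6 2 (a.2.1 : ℕ) (4 * (a.1 : ℕ)) a.2.2 0 := by
    intro a
    unfold ps
    rw [show δ - (δ + 4 * ((a.1 : ℕ) : ℤ)) - 1 = 0 - 4 * ((a.1 : ℕ) : ℤ) - 1 by ring]
    rfl
  rw [hps, hps] at h1
  have : ∀ a b : Fin 3 × Fin 2 × Bool, ps 6 2 (b.2.1 : ℕ) (4 * (b.1 : ℕ)) b.2.2 0 =
      ps 6 2 (a.2.1 : ℕ) (4 * (a.1 : ℕ)) a.2.2 0 → a = b := by decide +kernel
  exact this a b h1

/-- The linear bijection with prescribed values at two independent vectors. -/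
theorem exists_linearEquiv {a a' c c' p p' q q' : ℝ} (h : a * c' - a' * c ≠ 0)
    (h' : p * q' - p' * q ≠ 0) :
    ∃ f : EuclideanSpace ℝ (Fin 2) ≃ₗ[ℝ] EuclideanSpace ℝ (Fin 2),
      f !₂[a, a'] = !₂[p, p'] ∧ f !₂[c, c'] = !₂[q, q'] := by
  have key : ∀ {a a' c c' p p' q q' : ℝ}, a * c' - a' * c ≠ 0 →
      ∃ f : EuclideanSpace ℝ (Fin 2) →ₗ[ℝ] EuclideanSpace ℝ (Fin 2),
        (f !₂[a, a'] = !₂[p, p'] ∧ f !₂[c, c'] = !₂[q, q']) := by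
    intro a a' c c' p p' q q' h
    obtain ⟨ι, hι⟩ : ∃ ι, ι * (a * c' - a' * c) = 1 := ⟨_, inv_mul_cancel₀ h⟩
    refine ⟨{ toFun := fun v => (ι * (v 0 * c' - v 1 * c)) • !₂[p, p'] +
                (ι * (a * v 1 - a' * v 0)) • !₂[q, q']
              map_add' := ?_
              map_smul' := ?_ }, ?_, ?_⟩
    · intro v w
      ext i
      fin_cases i <;> simp <;> ring
    · intro r v
      ext i
      fin_cases i <;> simp <;> ring
    · ext i
      fin_cases i <;> simp
      · linear_combination p * hι
      · linear_combination p' * hι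
    · ext i
      fin_cases i <;> simp
      · linear_combination q * hι
      · linear_combination q' * hι
  obtain ⟨f, f1, f2⟩ := key (p := p) (p' := p') (q := q) (q' := q') h
  obtain ⟨f', f1', f2'⟩ := key (p := a) (p' := a') (q := c) (q' := c') h'
  have span : ∀ {a a' c c' : ℝ}, a * c' - a' * c ≠ 0 → ∀ v : EuclideanSpace ℝ (Fin 2),
      ∃ r s : ℝ, v = r • !₂[a, a'] + s • !₂[c, c'] := by
    intro a a' c c' h v
    obtain ⟨ι, hι⟩ : ∃ ι, ι * (a * c' - a' * c) = 1 := ⟨_, inv_mul_cancel₀ h⟩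
    refine ⟨ι * (v 0 * c' - v 1 * c), ι * (a * v 1 - a' * v 0), ?_⟩
    ext i
    fin_cases i <;> simp
    · linear_combination -v 0 * hι
    · linear_combination -v 1 * hι
  refine ⟨LinearEquiv.ofLinearMap f f' ?_ ?_, f1, f2⟩
  · ext1 v
    obtain ⟨r, s, rfl⟩ := span h' v
    simp only [LinearMap.comp_apply, LinearMap.id_apply, map_add, map_smul, f1, f2, f1', f2']
  · ext1 v
    obtain ⟨r, s, rfl⟩ := span h v
    simp only [LinearMap.comp_apply, LinearMap.id_apply, map_add, map_smul, f1, f2, f1', f2']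

/-- The points of an outer affinely regular hexagon and of the inner one. -/
theorem affinelyEquivalent_of_hexagons {x : Fin 3 → Fin 2 → Bool → EuclideanSpace ℝ (Fin 2)}
    {y : Fin 3 → Fin 2 → EuclideanSpace ℝ (Fin 2)} {z : EuclideanSpace ℝ (Fin 2)} {α : ℝ}
    (hx : ∀ j k s, x j k s = z + (if s then 1 else -1 : ℝ) • y j k)
    (hy : y 0 0 0 * y 2 0 1 - y 0 0 1 * y 2 0 0 ≠ 0) (hy1 : y 1 0 = y 0 0 + y 2 0)
    (hα : 0 < α) (hα1 : α ^ 2 + α = 1) (hyα : ∀ j, y j 1 = α • y j 0) :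
    AffinelyEquivalent {p | ∃ j k s, x j k s = p} Z5_12_6 := by
  have τ0 := goldenRatio_pos
  have τ2 := goldenRatio_sq
  have hατ : α * goldenRatio = 1 := by
    -- The two roots of α² + α = 1 are τ - 1 and -τ.
    have : (α - (goldenRatio - 1)) * (α + goldenRatio) = 0 := by linear_combination hα1 - τ2
    have h := (mul_eq_zero.1 this).resolve_right (by positivity)
    linear_combination goldenRatio * h + τ2
  -- The images of a and c are outer points of `Z5_12_6`; that of b is then (τ, τ), and the inner
  -- points follow from ατ = 1.
  obtain ⟨f, f1, f2⟩ := exists_linearEquiv (p := 2 * goldenRatio) (p' := 0) (q := -goldenRatio)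
    (q' := goldenRatio) hy (by simpa using τ0.ne')
  have eta : ∀ v : EuclideanSpace ℝ (Fin 2), !₂[v 0, v 1] = v := by
    intro v
    ext i
    fin_cases i <;> rfl
  rw [eta] at f1 f2
  have f3 : f (y 1 0) = !₂[goldenRatio, goldenRatio] := by
    rw [hy1, map_add, f1, f2]
    ext i
    fin_cases i <;> simp
    ring
  have i1 : f (y 0 1) = !₂[2, 0] := by
    rw [hyα, map_smul, f1]
    ext i
    fin_cases i <;> simp
    linear_combination 2 * hατ
  have i2 : f (y 2 1) = !₂[-1, 1] := by
    rw [hyα, map_smul, f2]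
    ext i
    fin_cases i <;> simp [hατ]
  have i3 : f (y 1 1) = !₂[1, 1] := by
    rw [hyα, map_smul, f3]
    ext i
    fin_cases i <;> simp [hατ]
  let e : EuclideanSpace ℝ (Fin 2) ≃ᵃ[ℝ] EuclideanSpace ℝ (Fin 2) :=
    (AffineEquiv.constVAdd ℝ (EuclideanSpace ℝ (Fin 2)) (-z)).trans f.toAffineEquiv
  have he : ∀ j k s, e (x j k s) = (if s then 1 else -1 : ℝ) • f (y j k) := by
    intro j k s
    rw [hx, ← map_smul]
    simp [e]
  have neg : ∀ a b : ℝ, (-1 : ℝ) • !₂[a, b] = !₂[-a, -b] := by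
    intro a b
    ext i
    fin_cases i <;> simp
  have fin2 : ∀ k : Fin 2, k = 0 ∨ k = 1 := by decide
  have fin3 : ∀ k : Fin 3, k = 0 ∨ k = 1 ∨ k = 2 := by decide
  refine ⟨e, Set.Subset.antisymm ?_ ?_⟩
  · rintro _ ⟨_, ⟨j, k, s, rfl⟩, rfl⟩
    rw [he]
    rcases fin3 j with rfl | rfl | rfl <;> rcases fin2 k with rfl | rfl <;> cases s <;>
      simp [Z5_12_6, f1, f2, f3, i1, i2, i3, neg]
  · have mem : ∀ j k (s : Bool) p, (if s then 1 else -1 : ℝ) • f (y j k) = p →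
        p ∈ e '' {p | ∃ j k s, x j k s = p} := by
      rintro j k s p rfl
      exact ⟨x j k s, ⟨j, k, s, rfl⟩, he j k s⟩
    intro p hp
    simp only [Z5_12_6, Set.mem_insert_iff, Set.mem_singleton_iff] at hp
    rcases hp with rfl | rfl | rfl | rfl | rfl | rfl | rfl | rfl | rfl | rfl | rfl | rfl
    · exact mem 0 1 true _ (by simp [i1])
    · exact mem 0 1 false _ (by simp [i1, neg])
    · exact mem 0 0 true _ (by simp [f1])
    · exact mem 0 0 false _ (by simp [f1, neg])
    · exact mem 1 1 true _ (by simp [i3])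
    · exact mem 2 1 false _ (by simp [i2, neg])
    · exact mem 2 1 true _ (by simp [i2])
    · exact mem 1 1 false _ (by simp [i3, neg])
    · exact mem 1 0 true _ (by simp [f3])
    · exact mem 2 0 false _ (by simp [f2, neg])
    · exact mem 2 0 true _ (by simp [f2])
    · exact mem 1 0 false _ (by simp [f3, neg])

/-- All realizations of three blocks of size two are affinely equivalent. -/
theorem IsDC.affinelyEquivalent {n : ℕ} {A : AllowableSequence (2 * n)} {d : Fin 3 → ℕ}
    (hA : A.IsDC d) (hn : n = ∑ i, d i) (hd : ∀ i, d i = 2) {P : Set (EuclideanSpace ℝ (Fin 2))}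
    (hP : A.IsRealization P) : AffinelyEquivalent P Z5_12_6 := by
  have hn6 : n = 6 := by rw [hn]; simp [hd]
  obtain ⟨δ, g, hg⟩ := hA.exists_three_blocks hn (fun i => by rw [hd]; norm_num) le_rfl 0 (hd _)
    (hd _) (hd _)
  obtain ⟨x, rfl, c, R⟩ := (isRealization_iff _ _).1 hP
  have hh : A.h = 2 * n := hA.evenNearCritical.2
  obtain ⟨-, h1, h2, α, h3, h4, h5⟩ := R.rigid hn6.ge hh hg (fun _ _ => rfl)
  -- `midpoint_eq` compares different blocks, so two pairs of block 0 are compared through block 1.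
  have mid : ∀ j k, x (g j k true) + x (g j k false) = x (g 0 0 true) + x (g 0 0 false) := by
    intro j k
    by_cases hj : 0 < j
    · exact (R.midpoint_eq hn6.ge hh hg hj 0 k).symm
    · have : j = 0 := by simpa using hj
      subst this
      have l01 : (0 : Fin 3) < 1 := by decide
      rw [R.midpoint_eq hn6.ge hh hg l01 k 0, R.midpoint_eq hn6.ge hh hg l01 0 0]
  have hset : Set.range x = {p | ∃ j k s, x (g j k s) = p} := by
    ext p
    constructor
    · rintro ⟨q, rfl⟩
      obtain ⟨⟨j, k, s⟩, rfl⟩ := (surjective_of_three_blocks hn6 hg).2 q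
      exact ⟨j, k, s, rfl⟩
    · rintro ⟨j, k, s, rfl⟩
      exact ⟨_, rfl⟩
  rw [hset]
  refine affinelyEquivalent_of_hexagons (x := fun j k s => x (g j k s))
    (y := fun j k => (1 / 2 : ℝ) • (x (g j k true) - x (g j k false)))
    (z := (1 / 2 : ℝ) • (x (g 0 0 true) + x (g 0 0 false))) (α := α) ?_ ?_ ?_ h3 h4 ?_
  · intro j k s
    rw [← mid j k]
    cases s <;> simp <;> module
  · simp only [PiLp.smul_apply, smul_eq_mul]
    intro h
    apply h1
    linear_combination 4 * h
  · rw [h2, smul_add]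
  · intro j
    rw [h5, smul_comm]

/-- A realizable sequence with three consecutive blocks of size two has no other blocks. -/
theorem IsDC.eq_three {n t : ℕ} [NeZero t] {A : AllowableSequence (2 * n)} {d : Fin t → ℕ}
    (hA : A.IsDC d) (hn : n = ∑ i, d i) (hd : ∀ i, 0 < d i) (ht : 3 ≤ t)
    (i : Fin t) (h0 : d i = 2) (h1 : d (i + 1) = 2) (h2 : d (i + 2) = 2) (hr : A.IsRealizable) :
    t = 3 := by
  -- Every entry is at least 1 and three distinct ones are 2; together with n = 6 this leaves t ≤ 3.
  have hle : t + 3 ≤ n := by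
    have v1 : ((1 : Fin t) : ℕ) = 1 := by rw [Fin.val_one', Nat.mod_eq_of_lt (by omega)]
    have v2 : ((2 : Fin t) : ℕ) = 2 := by
      change 2 % t = 2
      exact Nat.mod_eq_of_lt (by omega)
    have n1 : i ≠ i + 1 := fun h => by
      have := congrArg Fin.val (left_eq_add.1 h)
      rw [v1] at this
      simp at this
    have n2 : i ≠ i + 2 := fun h => by
      have := congrArg Fin.val (left_eq_add.1 h)
      rw [v2] at this
      simp at this
    have n3 : i + 1 ≠ i + 2 := fun h => by
      have := congrArg Fin.val (add_left_cancel h)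
      omega
    have e1 : ∑ j, d j = ∑ j, (d j - 1) + t := by
      have : ∑ j, d j = ∑ j, ((d j - 1) + 1) :=
        Finset.sum_congr rfl fun j _ => by have := hd j; omega
      rw [this, Finset.sum_add_distrib]
      simp
    have e2 : ∑ j ∈ {i, i + 1, i + 2}, (d j - 1) ≤ ∑ j, (d j - 1) :=
      Finset.sum_le_sum_of_subset (Finset.subset_univ _)
    rw [Finset.sum_insert (by simp [n1, n2]), Finset.sum_insert (by simp [n3]),
      Finset.sum_singleton, h0, h1, h2] at e2
    omega
  obtain ⟨δ, g, hg⟩ := hA.exists_three_blocks hn hd ht i h0 h1 h2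
  obtain ⟨P, hP⟩ := hr
  obtain ⟨x, -, c, R⟩ := (isRealization_iff _ _).1 hP
  have := (R.rigid (by omega) hA.evenNearCritical.2 hg (fun _ _ => rfl)).1
  omega

end AllowableSequence

namespace AllowableSequence

open DCExistence Real

/-! ### A realization of three blocks of size two

Its coordinates lie in the ring of all `p + q * α`, where `α ^ 2 + α = 1`; they are represented by
the pairs `(p, q)`. -/

namespace GoldenPair

/-- The product of `p + q * α` and `r + s * α`. -/
def mul (a b : ℤ × ℤ) : ℤ × ℤ := (a.1 * b.1 + a.2 * b.2, a.1 * b.2 + a.2 * b.1 - a.2 * b.2)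

/-- A sufficient condition for `p + q * α` to be positive. -/
def Pos (a : ℤ × ℤ) : Prop := 0 < 34 * a.1 + 21 * a.2 ∧ 0 < 55 * a.1 + 34 * a.2

instance : DecidablePred Pos := fun _ => inferInstanceAs (Decidable (_ ∧ _))

/-- The real number `p + q * α`. -/
noncomputable def val (a : ℤ × ℤ) : ℝ := a.1 + a.2 * (Real.goldenRatio - 1)

theorem val_mul (a b : ℤ × ℤ) : val (mul a b) = val a * val b := by
  have := Real.goldenRatio_sq
  unfold val mul
  push_cast
  linear_combination (-(a.2 : ℝ) * b.2) * this

theorem val_add (a b : ℤ × ℤ) : val (a + b) = val a + val b := by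
  unfold val
  push_cast [Prod.fst_add, Prod.snd_add]
  ring

theorem val_sub (a b : ℤ × ℤ) : val (a - b) = val a - val b := by
  unfold val
  push_cast [Prod.fst_sub, Prod.snd_sub]
  ring

theorem val_neg (a : ℤ × ℤ) : val (-a) = -val a := by
  unfold val
  push_cast [Prod.fst_neg, Prod.snd_neg]
  ring

theorem val_zero : val 0 = 0 := by simp [val]

/-- The Fibonacci quotients 21/34 and 34/55 enclose α; an affine function positive at both is
positive at α. -/
theorem val_pos {a : ℤ × ℤ} (h : Pos a) : 0 < val a := by
  have h1 : (0 : ℝ) < 34 * a.1 + 21 * a.2 := by exact_mod_cast h.1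
  have h2 : (0 : ℝ) < 55 * a.1 + 34 * a.2 := by exact_mod_cast h.2
  have h3 := Real.goldenRatio_sq
  have h4 := Real.goldenRatio_pos
  have l1 : 55 / 34 < Real.goldenRatio := by nlinarith
  have l2 : Real.goldenRatio < 89 / 55 := by nlinarith
  unfold val
  rcases le_total 0 (a.2 : ℝ) with h | h <;> nlinarith

/-- The points: the outer and the inner point of each block. -/
def point (j : Fin 3) (k : Fin 2) (s : Bool) : (ℤ × ℤ) × (ℤ × ℤ) :=
  -- The outer vectors a, b = a + c and c, in coordinates in which no critical direction is
  -- vertical.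
  let v : (ℤ × ℤ) × (ℤ × ℤ) := ![((1, 0), (1, 0)), ((1, 0), (3, 0)), ((0, 0), (2, 0))] j
  let w : (ℤ × ℤ) × (ℤ × ℤ) := if k = 0 then v else (mul (0, 1) v.1, mul (0, 1) v.2)
  if s then w else -w

/-- Vectors in the critical directions of a halfperiod. -/
def direction : Fin 12 → (ℤ × ℤ) × (ℤ × ℤ) :=
  -- The entries 0, 4 and 8 are orthogonal to a, b and c: they are the directions of the crossing
  -- switches.
  ![((1, 0), (-1, 0)), ((1, 3), (-1, -1)), ((4, 0), (-2, 0)), ((3, 1), (-1, -1)),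
    ((3, 0), (-1, 0)), ((3, 2), (-1, 0)), ((5, 0), (-1, 0)), ((2, 3), (0, -1)),
    ((2, 0), (0, 0)), ((-1, 3), (1, -1)), ((1, 0), (1, 0)), ((-1, 2), (1, 0))]

/-- The inner product. -/
def dot (v w : (ℤ × ℤ) × (ℤ × ℤ)) : ℤ × ℤ := mul v.1 w.1 + mul v.2 w.2

/-- The critical direction which follows the one with index `e`. -/
def nextDirection (e : Fin 12) : (ℤ × ℤ) × (ℤ × ℤ) :=
  if e = 11 then -direction 0 else direction (e + 1)

theorem direction_pos (e : Fin 12) : Pos (direction e).1 := by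
  revert e; decide

theorem direction_turn (e : Fin 11) :
    Pos (mul (direction e.castSucc).1 (direction e.succ).2 -
      mul (direction e.castSucc).2 (direction e.succ).1) := by
  revert e; decide

/-- A linear form that is nonnegative at two successive directions and positive at one of them is
positive in between, and it is zero at an end exactly for points that meet there. The permutation
after direction `e` is the one reached by `e + 1` moves. -/
theorem order_check (e : Fin 12) (a b : Fin 3 × Fin 2 × Bool)
    (h : ps 6 2 (a.2.1 : ℕ) (4 * (a.1 : ℕ)) a.2.2 (e + 1 : ℕ) <
      ps 6 2 (b.2.1 : ℕ) (4 * (b.1 : ℕ)) b.2.2 (e + 1 : ℕ)) :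
    let v := point b.1 b.2.1 b.2.2 - point a.1 a.2.1 a.2.2
    (Pos (dot v (direction e)) ∧ dot v (nextDirection e) = 0) ∨
      (dot v (direction e) = 0 ∧ Pos (dot v (nextDirection e))) ∨
      (Pos (dot v (direction e)) ∧ Pos (dot v (nextDirection e))) := by
  revert e a b
  decide +kernel

end GoldenPair

end AllowableSequence

/-! ### From critical directions to a realization. -/

namespace AllowableSequence

open DCExistence Real

/-- An increasing finite sequence of slopes gives a periodic increasing sequence of angles. -/
theorem exists_angles {h : ℕ} (h0 : 0 < h) {T : Fin h → ℝ} (hT : StrictMono T) :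
    ∃ c : ℤ → ℝ, StrictMono c ∧ (∀ e, c (e + h) = c e + π) ∧ ∀ e : Fin h, c (e : ℕ) = arctan (T e) := by
  have hh : (0 : ℤ) < h := by exact_mod_cast h0
  let r : ℤ → Fin h := fun e => ⟨(e % h).toNat, by
    have := Int.emod_nonneg e hh.ne'
    have := Int.emod_lt_of_pos e hh
    omega⟩
  have rv : ∀ e, ((r e : ℕ) : ℤ) = e % h := fun e => Int.toNat_of_nonneg (Int.emod_nonneg e hh.ne')
  -- The angles of one halfperiod lie in (-π/2, π/2), so their translates by multiples of π follow
  -- each other in order.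
  refine ⟨fun e => arctan (T (r e)) + π * ((e / h : ℤ) : ℝ), ?_, ?_, ?_⟩
  · refine strictMono_int_of_lt_succ fun e => ?_
    have h1 := Int.emod_nonneg e hh.ne'
    have h2 := Int.emod_lt_of_pos e hh
    have h3 := Int.mul_ediv_add_emod e h
    by_cases hr : e % h + 1 < h
    · have h4 := (Int.ediv_emod_unique (a := e + 1) (b := h) (r := e % h + 1) (q := e / h) hh).2
        ⟨by linarith, by omega, hr⟩
      rw [h4.1]
      have : r e < r (e + 1) := by
        have := rv e
        have := rv (e + 1)
        rw [Fin.lt_def]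
        omega
      have := arctan_strictMono (hT this)
      linarith
    · have h4 := (Int.ediv_emod_unique (a := e + 1) (b := h) (r := 0) (q := e / h + 1) hh).2
        ⟨by linarith, by omega, hh⟩
      rw [h4.1]
      have := arctan_lt_pi_div_two (T (r e))
      have := neg_pi_div_two_lt_arctan (T (r (e + 1)))
      push_cast
      linarith
  · intro e
    have h1 : r (e + h) = r e := by
      apply Fin.ext
      have h1 := rv e
      have h2 := rv (e + h)
      rw [Int.add_emod_right] at h2
      omega
    simp only [h1, Int.add_ediv_of_dvd_right (dvd_refl (h : ℤ)), Int.ediv_self hh.ne']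
    push_cast
    ring
  · intro e
    have h1 : ((e : ℕ) : ℤ) % h = (e : ℕ) := Int.emod_eq_of_lt (by omega) (by omega)
    have h2 : ((e : ℕ) : ℤ) / h = 0 := Int.ediv_eq_zero_of_lt (by omega) (by omega)
    have h3 : r (e : ℕ) = e := by
      apply Fin.ext
      have := rv (e : ℕ)
      omega
    simp only [h2, h3]
    simp

/-- A linear form on directions is positive between two directions if it is nonnegative at both of
them and positive at one of them. -/
theorem proj_pos_of_between {v w α β φ : ℝ} (h1 : α < φ) (h2 : φ < β) (h3 : β < α + π)
    (hα : 0 ≤ v * cos α + w * sin α) (hβ : 0 ≤ v * cos β + w * sin β)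
    (h : 0 < v * cos α + w * sin α ∨ 0 < v * cos β + w * sin β) :
    0 < v * cos φ + w * sin φ := by
  have s1 : 0 < sin (β - α) := sin_pos_of_pos_of_lt_pi (by linarith) (by linarith)
  have s2 : 0 < sin (β - φ) := sin_pos_of_pos_of_lt_pi (by linarith) (by linarith)
  have s3 : 0 < sin (φ - α) := sin_pos_of_pos_of_lt_pi (by linarith) (by linarith)
  have key : sin (β - α) * (v * cos φ + w * sin φ) =
      sin (β - φ) * (v * cos α + w * sin α) + sin (φ - α) * (v * cos β + w * sin β) := by
    simp only [sin_sub]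
    ring
  have : 0 < sin (β - α) * (v * cos φ + w * sin φ) := by
    rw [key]
    rcases h with h | h
    · have := mul_pos s2 h
      have := mul_nonneg s3.le hβ
      linarith
    · have := mul_pos s3 h
      have := mul_nonneg s2.le hα
      linarith
  exact pos_of_mul_pos_right this s1.le

namespace GoldenPair

theorem slope_strictMono :
    StrictMono fun e : Fin 12 => val (direction e).2 / val (direction e).1 := by
  rw [Fin.strictMono_iff_lt_succ]
  intro e
  have h1 := val_pos (direction_pos e.castSucc)
  have h2 := val_pos (direction_pos e.succ)
  have h3 := val_pos (direction_turn e)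
  rw [val_sub, val_mul, val_mul] at h3
  rw [div_lt_div_iff₀ h1 h2]
  linarith

/-- The projection of a point. -/
noncomputable def proj (a : Fin 3 × Fin 2 × Bool) (φ : ℝ) : ℝ :=
  val (point a.1 a.2.1 a.2.2).1 * cos φ + val (point a.1 a.2.1 a.2.2).2 * sin φ

/-- Up to positive factors the unit vectors at the two ends of the interval are `direction e` and
`nextDirection e`, so `order_check` and `proj_pos_of_between` apply. -/
theorem proj_lt {c : ℤ → ℝ} (hc : StrictMono c) (hπ : ∀ e, c (e + 12) = c e + π)
    (ht : ∀ e : Fin 12, c (e : ℕ) = arctan (val (direction e).2 / val (direction e).1))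
    (e : Fin 12) {φ : ℝ} (hφ : φ ∈ Set.Ioo (c (e : ℕ)) (c ((e : ℕ) + 1)))
    {a b : Fin 3 × Fin 2 × Bool}
    (h : ps 6 2 (a.2.1 : ℕ) (4 * (a.1 : ℕ)) a.2.2 ((e : ℕ) + 1) <
      ps 6 2 (b.2.1 : ℕ) (4 * (b.1 : ℕ)) b.2.2 ((e : ℕ) + 1)) : proj a φ < proj b φ := by
  have dotval : ∀ v w, val (dot v w) = val v.1 * val w.1 + val v.2 * val w.2 := by
    intro v w
    rw [dot, val_add, val_mul, val_mul]
  have hdir : ∀ e : Fin 12, ∃ κ, 0 < κ ∧ ∀ v, val v.1 * cos (c (e : ℕ)) +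
      val v.2 * sin (c (e : ℕ)) = κ * val (dot v (direction e)) := by
    intro e
    have h1 := val_pos (direction_pos e)
    refine ⟨cos (c (e : ℕ)) / val (direction e).1, div_pos (by rw [ht]; exact cos_arctan_pos _) h1,
      fun v => ?_⟩
    have h2 := tan_mul_cos (x := c (e : ℕ)) (by rw [ht]; exact (cos_arctan_pos _).ne')
    rw [ht, tan_arctan, ← ht] at h2
    rw [dotval, ← h2]
    field_simp
  have hnext : ∃ κ, 0 < κ ∧ ∀ v, val v.1 * cos (c ((e : ℕ) + 1)) +
      val v.2 * sin (c ((e : ℕ) + 1)) = κ * val (dot v (nextDirection e)) := by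
    by_cases he : e = 11
    · obtain ⟨κ, h1, h2⟩ := hdir 0
      refine ⟨κ, h1, fun v => ?_⟩
      have h3 := h2 v
      have h4 := hπ 0
      rw [show ((e : ℕ) : ℤ) + 1 = 0 + 12 by rw [he]; rfl, h4, cos_add_pi, sin_add_pi]
      rw [dotval] at h3 ⊢
      rw [nextDirection, if_pos he, Prod.fst_neg, Prod.snd_neg, val_neg, val_neg]
      simp only [Fin.val_zero, Nat.cast_zero] at h3
      linarith
    · obtain ⟨κ, h1, h2⟩ := hdir (e + 1)
      have hv : ((e + 1 : Fin 12) : ℕ) = e + 1 :=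
        Fin.val_add_one_of_lt (lt_of_le_of_ne (Fin.le_last e) he)
      rw [hv] at h2
      push_cast at h2
      refine ⟨κ, h1, fun v => ?_⟩
      rw [nextDirection, if_neg he]
      exact h2 v
  obtain ⟨κ, κ0, hκ⟩ := hdir e
  obtain ⟨ν, ν0, hν⟩ := hnext
  have hκ' := hκ (point b.1 b.2.1 b.2.2 - point a.1 a.2.1 a.2.2)
  have hν' := hν (point b.1 b.2.1 b.2.2 - point a.1 a.2.1 a.2.2)
  have hch := order_check e a b (by exact_mod_cast h)
  simp only at hch
  have hlt : c ((e : ℕ) + 1) < c (e : ℕ) + π := by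
    rw [← hπ]
    exact hc (by omega)
  have hp : 0 < val (point b.1 b.2.1 b.2.2 - point a.1 a.2.1 a.2.2).1 * cos φ +
      val (point b.1 b.2.1 b.2.2 - point a.1 a.2.1 a.2.2).2 * sin φ := by
    have key : ∀ X Y : ℝ, (0 < X ∧ Y = 0) ∨ (X = 0 ∧ 0 < Y) ∨ (0 < X ∧ 0 < Y) →
        0 ≤ X ∧ 0 ≤ Y ∧ (0 < X ∨ 0 < Y) := by
      rintro X Y (⟨h1, h2⟩ | ⟨h1, h2⟩ | ⟨h1, h2⟩)
      · exact ⟨h1.le, h2.ge, Or.inl h1⟩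
      · exact ⟨h1.ge, h2.le, Or.inr h2⟩
      · exact ⟨h1.le, h2.le, Or.inl h1⟩
    have zero : ∀ {v} (κ : ℝ), v = 0 → κ * val v = 0 := by
      rintro v κ rfl
      rw [val_zero, mul_zero]
    obtain ⟨k1, k2, k3⟩ := key _ _ (hch.imp
      (And.imp (fun h => mul_pos κ0 (val_pos h)) (zero ν))
      (Or.imp (And.imp (zero κ) (fun h => mul_pos ν0 (val_pos h)))
        (And.imp (fun h => mul_pos κ0 (val_pos h)) (fun h => mul_pos ν0 (val_pos h)))))
    rw [← hκ'] at k1 k3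
    rw [← hν'] at k2 k3
    exact proj_pos_of_between hφ.1 hφ.2 hlt k1 k2 k3
  rw [Prod.fst_sub, Prod.snd_sub, val_sub, val_sub] at hp
  unfold proj
  linarith

/-- A half turn negates all projections, and twelve moves reverse all positions; so twelve intervals
decide all of them. -/
theorem proj_lt_of_lt {c : ℤ → ℝ} (hc : StrictMono c) (hπ : ∀ e, c (e + 12) = c e + π)
    (ht : ∀ e : Fin 12, c (e : ℕ) = arctan (val (direction e).2 / val (direction e).1))
    (e : ℤ) : ∀ φ ∈ Set.Ioo (c e) (c (e + 1)), ∀ a b : Fin 3 × Fin 2 × Bool,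
      ps 6 2 (a.2.1 : ℕ) (4 * (a.1 : ℕ)) a.2.2 (e + 1) <
        ps 6 2 (b.2.1 : ℕ) (4 * (b.1 : ℕ)) b.2.2 (e + 1) → proj a φ < proj b φ := by
  have hproj : ∀ a φ, proj a (φ + π) = -proj a φ := by
    intro a φ
    unfold proj
    rw [cos_add_pi, sin_add_pi]
    ring
  have hps : ∀ (a : Fin 3 × Fin 2 × Bool) e,
      ps 6 2 (a.2.1 : ℕ) (4 * (a.1 : ℕ)) a.2.2 (e + 12 + 1) =
        11 - ps 6 2 (a.2.1 : ℕ) (4 * (a.1 : ℕ)) a.2.2 (e + 1) := by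
    intro a e
    have := ps_add (n := 6) (A := 2) (k := (a.2.1 : ℕ)) (δ := 4 * (a.1 : ℕ)) (m := e + 1)
      (s := a.2.2) (by norm_num)
    rw [show e + 12 + 1 = e + 1 + 2 * 6 by ring, this]
    norm_num
  obtain ⟨P, hP⟩ : ∃ P : ℤ → Prop, ∀ e, P e ↔ ∀ φ ∈ Set.Ioo (c e) (c (e + 1)),
      ∀ a b : Fin 3 × Fin 2 × Bool, ps 6 2 (a.2.1 : ℕ) (4 * (a.1 : ℕ)) a.2.2 (e + 1) <
        ps 6 2 (b.2.1 : ℕ) (4 * (b.1 : ℕ)) b.2.2 (e + 1) → proj a φ < proj b φ := ⟨_, fun _ => Iff.rfl⟩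
  have hstep : ∀ e, P (e + 12) ↔ P e := by
    intro e
    have h1 : c (e + 12 + 1) = c (e + 1) + π := by
      rw [← hπ]
      ring_nf
    rw [hP, hP]
    constructor
    · intro h φ hφ a b hab
      have := h (φ + π) (by rw [hπ, h1]; exact ⟨by linarith [hφ.1], by linarith [hφ.2]⟩) b a
        (by rw [hps, hps]; linarith)
      rw [hproj, hproj] at this
      linarith
    · intro h φ hφ a b hab
      rw [hπ, h1] at hφ
      rw [hps, hps] at hab
      have := h (φ - π) ⟨by linarith [hφ.1], by linarith [hφ.2]⟩ b a (by linarith)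
      have ha := hproj a (φ - π)
      have hb := hproj b (φ - π)
      rw [sub_add_cancel] at ha hb
      linarith
  have hmul : ∀ e q : ℤ, P (e + 12 * q) ↔ P e := by
    intro e q
    induction q with
    | zero => simp
    | succ q ih => rw [← ih, ← hstep (e + 12 * q), mul_add, mul_one, add_assoc]
    | pred q ih =>
      rw [← ih, ← hstep (e + 12 * (-q - 1)), mul_sub, mul_one, add_assoc, sub_add_cancel]
  have h1 := Int.emod_nonneg e (b := 12) (by norm_num)
  have h2 := Int.emod_lt_of_pos e (b := 12) (by norm_num)
  rw [← hP, ← Int.emod_add_mul_ediv e 12, hmul, hP]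
  intro φ hφ a b hab
  have h3 : (((e % 12).toNat : ℕ) : ℤ) = e % 12 := Int.toNat_of_nonneg h1
  exact proj_lt hc hπ ht ⟨(e % 12).toNat, by omega⟩ (by simpa only [h3] using hφ)
    (by simpa only [h3] using hab)

end GoldenPair

/-- Three blocks of size two are realizable. -/
theorem IsDC.isRealizable {n : ℕ} {A : AllowableSequence (2 * n)} {d : Fin 3 → ℕ}
    (hA : A.IsDC d) (hn : n = ∑ i, d i) (hd : ∀ i, d i = 2) : A.IsRealizable := by
  have hn6 : n = 6 := by rw [hn]; simp [hd]
  obtain ⟨δ, g, hg⟩ := hA.exists_three_blocks hn (fun i => by rw [hd]; norm_num) le_rfl 0 (hd _)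
    (hd _) (hd _)
  have hh : A.h = 2 * n := hA.evenNearCritical.2
  let G := Equiv.ofBijective _ (surjective_of_three_blocks hn6 hg)
  obtain ⟨c, hc, hπ, ht⟩ := exists_angles (by norm_num) GoldenPair.slope_strictMono
  have hlt := GoldenPair.proj_lt_of_lt hc hπ ht
  have hpos : ∀ m p, ((A.pos m p : ℕ) : ℤ) = ps 6 2 ((G.symm p).2.1 : ℕ)
      (4 * ((G.symm p).1 : ℕ)) (G.symm p).2.2 (m - δ - 1 + 1) := by
    intro m p
    obtain ⟨a, rfl⟩ := G.surjective p
    rw [Equiv.symm_apply_apply]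
    have h1 : ((A.pos m (G a) : ℕ) : ℤ) = _ := hg m a.1 a.2.1 a.2.2
    rw [h1, hn6, ps, ps, show m - (δ + 4 * ((a.1 : ℕ) : ℤ)) - 1 =
      m - δ - 1 + 1 - 4 * ((a.1 : ℕ) : ℤ) - 1 by ring]
    rfl
  let x : Fin (2 * n) → EuclideanSpace ℝ (Fin 2) := fun p =>
    !₂[GoldenPair.val (GoldenPair.point (G.symm p).1 (G.symm p).2.1 (G.symm p).2.2).1,
      GoldenPair.val (GoldenPair.point (G.symm p).1 (G.symm p).2.1 (G.symm p).2.2).2]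
  -- The angle with index 0 belongs to the move from permutation `δ` to `δ + 1`, whence the shift by
  -- `δ + 1`.
  refine ⟨Set.range x, (isRealization_iff _ _).2 ⟨x, rfl, fun i => c (i - δ - 1), ?_, ?_, ?_⟩⟩
  · intro i j hij
    exact hc (by omega)
  · intro i
    rw [hh, hn6, ← hπ]
    congr 1
    push_cast
    ring
  · intro i φ hφ p q
    rw [show i + 1 - δ - 1 = i - δ - 1 + 1 by ring] at hφ
    have key : ∀ p q, A.pos i p < A.pos i q →
        x p 0 * cos φ + x p 1 * sin φ < x q 0 * cos φ + x q 1 * sin φ := by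
      intro p q hpq
      have h1 : ((A.pos i p : ℕ) : ℤ) < (A.pos i q : ℕ) := by exact_mod_cast hpq
      rw [hpos, hpos] at h1
      exact hlt _ φ hφ _ _ h1
    refine ⟨key p q, fun h => ?_⟩
    by_contra hcon
    rcases lt_or_eq_of_le (not_lt.1 hcon) with h1 | h1
    · exact absurd h (not_lt.2 (key q p h1).le)
    · rw [(A.pos i).injective h1] at h
      exact lt_irrefl _ h

end AllowableSequence

theorem theorem4p8 (t : ℕ) [NeZero t] (ht : 3 ≤ t) (d : Fin t → ℕ) (hd : ∀ i, 0 < d i)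
    (h2 : ∃ i : Fin t, d i = 2 ∧ d (i + 1) = 2 ∧ d (i + 2) = 2) :
    ((DC d (by omega) hd).IsRealizable ↔ t = 3) ∧
      ∀ P : Set (EuclideanSpace ℝ (Fin 2)),
        (DC ![2, 2, 2] (by norm_num) (by decide)).IsRealization P →
          AffinelyEquivalent P Z5_12_6 := by
  obtain ⟨i, hi0, hi1, hi2⟩ := h2
  -- For t = 3 the three cyclically consecutive entries are all entries of `d`.
  have three : ∀ i j : Fin 3, j = i ∨ j = i + 1 ∨ j = i + 2 := by decide
  refine ⟨⟨(DC_isDC d (by omega) hd).eq_three rfl hd ht i hi0 hi1 hi2, ?_⟩, fun P hP => ?_⟩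
  · rintro rfl
    refine (DC_isDC d (by omega) hd).isRealizable rfl fun j => ?_
    rcases three i j with rfl | rfl | rfl
    · exact hi0
    · exact hi1
    · exact hi2
  · exact (DC_isDC _ _ _).affinelyEquivalent rfl (by decide) hP
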